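/- Let $\mathbb H$ be the quaternions with imaginary units $i_1,i_2,i_3$, let $\mathcal U_1=\{(q_1,q_2)\in\mathbb H^2:\ \operatorname{Re}q_2>|q_1|^2\}$ be the Siegel half space and $\partial\mathcal U_1=\{(q_1,q_2)\in\mathbb H^2:\ \operatorname{Re}q_2=|q_1|^2\}$ its boundary, and let $\beta$ be the measure on $\partial\mathcal U_1$ obtained from Lebesgue measure $dw\,dt$ on $\mathbb H\times\mathbb R^3$ through the identification $(w,t)\mapsto(w,|w|^2+i_1t_1+i_2t_2+i_3t_3)$. Put $L^2(\partial\mathcal U_1)=L^2(\partial\mathcal U_1,\beta;\mathbb H)$. Call a smooth function $F:\mathcal U_1\to\mathbb H$ q-holomorphic if it satisfies the left Cauchy–Riemann–Fueter equation in each of the variables $q_k=x_0+i_1x_1+i_2x_2+i_3x_3$, $k=1,2$ (with the other variable fixed): $$\tfrac12\Big(\frac{\partial F}{\partial x_0}+\sum_{m=1}^{3}i_m\frac{\partial F}{\partial x_m}\Big)=0 .$$ Let $\mathbf e=(0,1)\in\mathbb H^2$ be the unit vector in the direction of $\operatorname{Re}q_2$. For $\varepsilon>0$ the vertical translate $F_\varepsilon(q)=F(q+\varepsilon\mathbf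 e)$ is defined on $\partial\mathcal U_1$. The Hardy space $\mathcal H^2(\mathcal U_1)$ consists of all q-holomorphic $F$ on $\mathcal U_1$ with $$\|F\|_{\mathcal H^2(\mathcal U_1)}^2:=\sup_{\varepsilon>0}\int_{\partial\mathcal U_1}|F(q+\varepsilon\mathbf e)|^2\,d\beta(q)<\infty .$$ **Theorem.** 1. For every $F\in\mathcal H^2(\mathcal U_1)$, the functions $F_\varepsilon|_{\partial\mathcal U_1}$ belong to $L^2(\partial\mathcal U_1)$ for all $\varepsilon>0$, and there is a unique $F^b\in L^2(\partial\mathcal U_1)$ such that $F_\varepsilon|_{\partial\mathcal U_1}\to F^b$ in the $L^2(\partial\mathcal U_1)$ norm as $\varepsilon\to0^+$. 2. The set $\{F^b:\ F\in\mathcal H^2(\mathcal U_1)\}$ is a closed linear subspace of $L^2(\partial\mathcal U_1)$ (linear over $\mathbb H$ acting by right multiplication, and so in particular over $\mathbb R$). 3. $\|F^b\|_{L^2(\partial\mathcal U_1)}=\|F\|_{\mathcal H^2(\mathcal U_1)}$ for every $F\in\mathcal H^2(\mathcal U_1)$. -/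

import Mathlib

open MeasureTheory Filter Topology
open scoped Quaternion ENNReal ContDiff

noncomputable section

namespace QuaternionSiegel

/-- The quaternions carry their Borel sigma-algebra. -/
instance instMeasurableSpaceQuaternion : MeasurableSpace ℍ[ℝ] := borel ℍ[ℝ]

instance instBorelSpaceQuaternion : BorelSpace ℍ[ℝ] := ⟨rfl⟩

/-- The imaginary unit `i₁`. -/
def i₁ : ℍ[ℝ] := ⟨0, 1, 0, 0⟩

/-- The imaginary unit `i₂`. -/
def i₂ : ℍ[ℝ] := ⟨0, 0, 1, 0⟩

/-- The imaginary unit `i₃`. -/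
def i₃ : ℍ[ℝ] := ⟨0, 0, 0, 1⟩

/-- The left Cauchy-Riemann-Fueter operator
`1/2 (∂/∂x₀ + i₁ ∂/∂x₁ + i₂ ∂/∂x₂ + i₃ ∂/∂x₃)` in one quaternionic variable
`x₀ + i₁ x₁ + i₂ x₂ + i₃ x₃`. -/
def dbarLeft (g : ℍ[ℝ] → ℍ[ℝ]) (p : ℍ[ℝ]) : ℍ[ℝ] :=
  (1 / 2 : ℝ) •
    (fderiv ℝ g p 1 + i₁ * fderiv ℝ g p i₁ + i₂ * fderiv ℝ g p i₂ + i₃ * fderiv ℝ g p i₃)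

/-- `F` is q-holomorphic on the open set `U`: it is smooth there (as a function of eight real
variables) and is annihilated by the left Cauchy-Riemann-Fueter operator in each of its two
quaternionic variables. -/
def QHolomorphicOn (F : ℍ[ℝ] × ℍ[ℝ] → ℍ[ℝ]) (U : Set (ℍ[ℝ] × ℍ[ℝ])) : Prop :=
  ContDiffOn ℝ ∞ F U ∧
    ∀ q ∈ U, dbarLeft (fun x => F (x, q.2)) q.1 = 0 ∧ dbarLeft (fun y => F (q.1, y)) q.2 = 0

/-- The Siegel half space `Re q₂ > |q₁|²`. -/
def siegel : Set (ℍ[ℝ] × ℍ[ℝ]) := {q | ‖q.1‖ ^ 2 < q.2.re}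

/-- Its boundary `Re q₂ = |q₁|²`. -/
def siegelBoundary : Set (ℍ[ℝ] × ℍ[ℝ]) := {q | q.2.re = ‖q.1‖ ^ 2}

/-- The identification `(w, t) ↦ (w, |w|² + i₁ t₁ + i₂ t₂ + i₃ t₃)` of `ℍ × ℝ³` with the
boundary. -/
def boundaryParam (p : ℍ[ℝ] × EuclideanSpace ℝ (Fin 3)) : siegelBoundary :=
  ⟨(p.1, ⟨‖p.1‖ ^ 2, p.2 0, p.2 1, p.2 2⟩), rfl⟩

/-- The measure on the boundary: the image of Lebesgue measure `dw dt` on `ℍ × ℝ³`. -/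
def beta : Measure siegelBoundary := Measure.map boundaryParam volume

/-- The unit vector in the direction of `Re q₂`. -/
def vert : ℍ[ℝ] × ℍ[ℝ] := (0, 1)

/-- The vertical translate `q ↦ F (q + ε e)`, restricted to the boundary. For `ε > 0` it only
involves the values of `F` on the Siegel half space. -/
def boundaryTranslate (F : ℍ[ℝ] × ℍ[ℝ] → ℍ[ℝ]) (ε : ℝ) (q : siegelBoundary) : ℍ[ℝ] :=
  F ((q : ℍ[ℝ] × ℍ[ℝ]) + ε • vert)

/-- `sup_{ε > 0} ∫ |F (q + ε e)|² dβ(q)`, as an extended nonnegative number. -/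
def hardySup (F : ℍ[ℝ] × ℍ[ℝ] → ℍ[ℝ]) : ℝ≥0∞ :=
  ⨆ (ε : ℝ) (_ : 0 < ε), ∫⁻ q, ‖boundaryTranslate F ε q‖ₑ ^ 2 ∂beta

/-- Membership in the Hardy space `H²` of the Siegel half space. -/
def MemHardy (F : ℍ[ℝ] × ℍ[ℝ] → ℍ[ℝ]) : Prop :=
  QHolomorphicOn F siegel ∧ hardySup F < ⊤

/-- The Hardy space norm. -/
def hardyNorm (F : ℍ[ℝ] × ℍ[ℝ] → ℍ[ℝ]) : ℝ := Real.sqrt (hardySup F).toReal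

/-- `G ∈ L²` is the limit in `L²` norm of the boundary restrictions of the vertical translates of
`F`, as `ε → 0+`. -/
def IsBoundaryValue (F : ℍ[ℝ] × ℍ[ℝ] → ℍ[ℝ]) (G : Lp ℍ[ℝ] 2 beta) : Prop :=
  Tendsto (fun ε : ℝ => eLpNorm (fun q => boundaryTranslate F ε q - G q) 2 beta) (𝓝[>] 0) (𝓝 0)

theorem measurable_boundaryParam : Measurable boundaryParam := by
  have h : Continuous boundaryParam := by
    refine Continuous.subtype_mk (Continuous.prodMk continuous_fst ?_) _
    refine (Quaternion.linearIsometryEquivTuple.symm.continuous).comp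
      (g := Quaternion.linearIsometryEquivTuple.symm)
      (f := fun p : ℍ[ℝ] × EuclideanSpace ℝ (Fin 3) =>
        !₂[‖p.1‖ ^ 2, p.2 0, p.2 1, p.2 2]) ?_
    fun_prop
  exact h.measurable

/-- The integration formula which characterises the measure on the boundary. -/
theorem lintegral_beta {f : siegelBoundary → ℝ≥0∞} (hf : Measurable f) :
    ∫⁻ q, f q ∂beta = ∫⁻ p, f (boundaryParam p) := by
  rw [beta, lintegral_map hf measurable_boundaryParam]

end QuaternionSiegel

end

open QuaternionSiegel

open QuaternionSiegel
open scoped NNReal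

/-! Let s be the height above the boundary and (w, t) the boundary coordinates. The equation in q₂
then reads ∂F/∂s = -∑ i_m ∂F/∂t_m. Left multiplication by i_m and ∂/∂t_m are both skew and commute,
so the operator on the right is formally self-adjoint on L²(dw dt). Hence the derivative in r of
⟨F_{a+r}, F_{b-r}⟩ vanishes, and ⟨F_a, F_b⟩ depends only on a + b (`integral_inner_siegelCoord_eq`).
The integration by parts is done with cut-offs, whose error is controlled by the uniform L² bound.

With k(s) = ‖F_s‖² it follows that ‖F_a - F_b‖² = k(a) + k(b) - 2k((a+b)/2). So k is midpoint convex
and bounded, hence nonincreasing, and it increases to its supremum as s → 0+. This makes F_s Cauchy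
at 0+, with a limit that dominates every ‖F_s‖ (`exists_tendsto_of_inner_eq_of_add_eq`). Existence
of the boundary value and equality of norms both come from here.

Closedness needs control of F inside the domain. A mean value property with a smooth radial weight
(`radialMass_smul_eq_integral`), proved directly from the first order equation and applied in each
variable, gives a smooth compactly supported reproducing kernel. The kernel bounds point values by
local L² norms and shows that locally uniform limits remain q-holomorphic. Integration over the
height bounds local L² norms by the Hardy norm (`exists_eLpNorm_le_hardySup`). Thus L² convergence
of boundary values forces locally uniform convergence of the functions; Fatou's lemma puts the limit
in the Hardy space, and the isometry identifies its boundary value. -/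

/-! ### Bounded orbits whose inner products depend only on the sum of the times -/

/-- A midpoint convex function on `(0, ∞)` which is bounded above is nonincreasing. -/
theorem le_of_midpoint_convex_of_bddAbove {k : ℝ → ℝ} {C : ℝ}
    (hmid : ∀ a b, 0 < a → 0 < b → 2 * k ((a + b) / 2) ≤ k a + k b)
    (hC : ∀ a, 0 < a → k a ≤ C) {a b : ℝ} (ha : 0 < a) (hab : a ≤ b) : k b ≤ k a := by
  by_contra! hlt
  have hne : a < b := lt_of_le_of_ne hab (by rintro rfl; exact lt_irrefl _ hlt)
  have hh : 0 < b - a := sub_pos.2 hne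
  have hpos : ∀ n : ℕ, 0 < a + n * (b - a) := fun n => by positivity
  -- Increments along the arithmetic progression a, b, 2b - a, … do not decrease, so a positive
  -- first increment forces linear growth, against the upper bound.
  have step : ∀ n : ℕ, k b - k a ≤ k (a + (n + 1 : ℕ) * (b - a)) - k (a + n * (b - a)) := by
    intro n
    induction n with
    | zero => simp
    | succ n ih =>
      have := hmid _ _ (hpos n) (hpos (n + 2))
      have e : (a + n * (b - a) + (a + (n + 2 : ℕ) * (b - a))) / 2
          = a + (n + 1 : ℕ) * (b - a) := by push_cast; ring
      rw [e] at this
      have e2 : n + 1 + 1 = n + 2 := rfl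
      rw [e2]
      linarith
  have lin : ∀ n : ℕ, k a + n * (k b - k a) ≤ k (a + n * (b - a)) := by
    intro n
    induction n with
    | zero => simp
    | succ n ih => have := step n; push_cast at this ⊢; linarith
  obtain ⟨n, hn⟩ := exists_nat_gt ((C - k a) / (k b - k a))
  rw [div_lt_iff₀ (sub_pos.2 hlt)] at hn
  linarith [lin n, hC _ (hpos n)]

/-- If the inner products `⟪V a, V b⟫` depend only on `a + b` and `V` is bounded, then `V` has a
limit at `0+`, whose norm dominates all the norms `‖V s‖`. -/
theorem exists_tendsto_of_inner_eq_of_add_eq {H : Type*} [NormedAddCommGroup H]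
    [InnerProductSpace ℝ H] [CompleteSpace H] {V : ℝ → H} {C : ℝ}
    (hV : ∀ a b c d, 0 < a → 0 < b → 0 < c → 0 < d → a + b = c + d →
      inner ℝ (V a) (V b) = inner ℝ (V c) (V d))
    (hC : ∀ a, 0 < a → ‖V a‖ ≤ C) :
    ∃ G, Tendsto V (𝓝[>] 0) (𝓝 G) ∧ ∀ s, 0 < s → ‖V s‖ ≤ ‖G‖ := by
  set k : ℝ → ℝ := fun s => ‖V s‖ ^ 2 with hk
  -- The cross term of the expanded square is moved to equal times by `hV`, where it becomes a value
  -- of `k`.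
  have hsub : ∀ a b, 0 < a → 0 < b → ‖V a - V b‖ ^ 2 = k a + k b - 2 * k ((a + b) / 2) := by
    intro a b ha hb
    have : inner ℝ (V a) (V b) = k ((a + b) / 2) := by
      rw [hV a b ((a + b) / 2) ((a + b) / 2) ha hb (by positivity) (by positivity) (by ring),
        real_inner_self_eq_norm_sq]
    rw [norm_sub_sq_real, this]
    simp only [hk]; ring
  have hmid : ∀ a b, 0 < a → 0 < b → 2 * k ((a + b) / 2) ≤ k a + k b := by
    intro a b ha hb
    linarith [hsub a b ha hb, sq_nonneg ‖V a - V b‖]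
  have hkC : ∀ a, 0 < a → k a ≤ C ^ 2 := fun a ha => by
    have := hC a ha
    simp only [hk]; gcongr
  have hanti : ∀ {a b}, 0 < a → a ≤ b → k b ≤ k a := fun ha hab =>
    le_of_midpoint_convex_of_bddAbove hmid hkC ha hab
  set K : ℝ := sSup (k '' Set.Ioi 0) with hK
  have hbdd : BddAbove (k '' Set.Ioi 0) := ⟨C ^ 2, by rintro _ ⟨a, ha, rfl⟩; exact hkC a ha⟩
  have hkK : ∀ a, 0 < a → k a ≤ K := fun a ha => le_csSup hbdd ⟨a, ha, rfl⟩
  have hcauchy : Cauchy (map V (𝓝[>] 0)) := by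
    rw [Metric.cauchy_iff]
    refine ⟨inferInstance, fun ε hε => ?_⟩
    -- For a, b < δ the midpoint is below δ too, so by monotonicity ‖V a - V b‖² ≤ 2K - 2k(δ) < ε²;
    -- hence the tolerance ε²/2.
    obtain ⟨_, ⟨δ, hδ, rfl⟩, hlt⟩ := exists_lt_of_lt_csSup (Set.Nonempty.image k ⟨1, one_pos⟩)
      (show K - ε ^ 2 / 2 < K by linarith [pow_pos hε 2])
    refine ⟨V '' Set.Ioo 0 δ, image_mem_map (Ioo_mem_nhdsGT hδ), ?_⟩
    rintro _ ⟨a, ha, rfl⟩ _ ⟨b, hb, rfl⟩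
    rw [dist_eq_norm]
    refine lt_of_pow_lt_pow_left₀ 2 hε.le ?_
    rw [hsub a b ha.1 hb.1]
    have h1 := hkK a ha.1
    have h2 := hkK b hb.1
    have h3 : k δ ≤ k ((a + b) / 2) :=
      hanti (by linarith [ha.1, hb.1]) (by linarith [ha.2, hb.2])
    linarith
  obtain ⟨G, hG⟩ := CompleteSpace.complete hcauchy
  have hG : Tendsto V (𝓝[>] 0) (𝓝 G) := hG
  refine ⟨G, hG, fun s hs => ?_⟩
  refine ge_of_tendsto hG.norm ?_
  filter_upwards [Ioo_mem_nhdsGT hs] with a ha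
  exact le_of_sq_le_sq (hanti ha.1 ha.2.le) (norm_nonneg _)

/-! ### Calculus tools -/

/-- Differentiation under the integral sign for integrands supported in a fixed compact set. -/
theorem hasDerivAt_integral_of_isCompact {X E : Type*} [TopologicalSpace X] [T2Space X]
    [MeasurableSpace X] [OpensMeasurableSpace X] [SecondCountableTopology X]
    {μ : Measure X} [IsFiniteMeasureOnCompacts μ]
    [NormedAddCommGroup E] [NormedSpace ℝ E] {f f' : ℝ → X → E} {K : Set X} (hK : IsCompact K)
    {s : Set ℝ} (hs : IsOpen s) {r : ℝ} (hr : r ∈ s)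
    (hf0 : ∀ t, ∀ x ∉ K, f t x = 0) (hf0' : ∀ t, ∀ x ∉ K, f' t x = 0)
    (hf : ∀ t ∈ s, ContinuousOn (f t) K) (hf' : ContinuousOn (Function.uncurry f') (s ×ˢ K))
    (hd : ∀ t ∈ s, ∀ x ∈ K, HasDerivAt (fun t => f t x) (f' t x) t) :
    HasDerivAt (fun t => ∫ x, f t x ∂μ) (∫ x, f' r x ∂μ) r := by
  obtain ⟨ε, hε, hball⟩ := Metric.nhds_basis_closedBall.mem_iff.1 (hs.mem_nhds hr)
  have hmeas : ∀ g : X → E, ContinuousOn g K → (∀ x ∉ K, g x = 0) → Integrable g μ := by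
    intro g hg h0
    have h1 : IntegrableOn g K μ := hg.integrableOn_compact hK
    have : g = K.indicator g := by
      ext x; by_cases hx : x ∈ K
      · simp [hx]
      · simp [hx, h0 x hx]
    rw [this]; exact h1.integrable_indicator hK.measurableSet
  have hf'K : ∀ t ∈ s, ContinuousOn (f' t) K := fun t ht =>
    hf'.comp (f := fun x => (t, x)) (by fun_prop) (fun x hx => ⟨ht, hx⟩)
  obtain ⟨M, hM⟩ := ((isCompact_closedBall r ε).prod hK).exists_bound_of_continuousOn
    (hf'.mono (Set.prod_mono hball le_rfl))
  refine (hasDerivAt_integral_of_dominated_loc_of_deriv_le (μ := μ) (F := f) (F' := f')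
    (bound := K.indicator fun _ => M) (Metric.closedBall_mem_nhds r hε)
    ?_ (hmeas _ (hf r hr) (hf0 r)) (hmeas _ (hf'K r hr) (hf0' r)).aestronglyMeasurable ?_ ?_ ?_).2
  · filter_upwards [hs.mem_nhds hr] with t ht
    exact (hmeas _ (hf t ht) (hf0 t)).aestronglyMeasurable
  · refine .of_forall fun x t ht => ?_
    by_cases hx : x ∈ K
    · simpa [hx] using hM (t, x) ⟨ht, hx⟩
    · simp [hx, hf0' t x hx]
  · exact (integrableOn_const (hK.measure_lt_top.ne)).integrable_indicator hK.measurableSet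
  · refine .of_forall fun x t ht => ?_
    by_cases hx : x ∈ K
    · exact hd t (hball ht) x hx
    · simp only [hf0' t x hx, hf0 _ x hx]; exact hasDerivAt_const _ _

/-- The integral of a directional derivative of a compactly supported function vanishes. -/
theorem integral_fderiv_apply_eq_zero {X E : Type*} [NormedAddCommGroup X] [NormedSpace ℝ X]
    [FiniteDimensional ℝ X] [MeasurableSpace X] [BorelSpace X] {μ : Measure X}
    [μ.IsAddHaarMeasure] [NormedAddCommGroup E] [NormedSpace ℝ E]
    {f : X → E} (hf : ContDiff ℝ 1 f) (hc : HasCompactSupport f) (v : X) :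
    ∫ x, fderiv ℝ f x v ∂μ = 0 := by
  have hcf : Continuous fun x => fderiv ℝ f x v :=
    (hf.continuous_fderiv one_ne_zero).clm_apply continuous_const
  have hi : Integrable (fun x => fderiv ℝ f x v) μ :=
    hcf.integrable_of_hasCompactSupport (hc.fderiv_apply (𝕜 := ℝ) v)
  have hi0 : Integrable f μ := hf.continuous.integrable_of_hasCompactSupport hc
  -- Integration by parts against the constant function 1.
  have := integral_smul_fderiv_eq_neg_fderiv_smul_of_integrable (μ := μ) (𝕜 := ℝ)
    (f := fun _ : X => (1 : ℝ)) (g := f) (v := v) (by simp)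
    (by simpa using hi) (by simpa using hi0) (fun _ _ => by fun_prop)
    (fun x _ => hf.differentiable one_ne_zero x)
  simpa using this

section

instance : (volume : Measure (ℍ[ℝ] × EuclideanSpace ℝ (Fin 3))).IsAddHaarMeasure :=
  Measure.prod.instIsAddHaarMeasure _ _

instance : (volume : Measure (ℍ[ℝ] × ℍ[ℝ])).IsAddHaarMeasure :=
  Measure.prod.instIsAddHaarMeasure _ _

/-! ### Coordinates on the Siegel half space -/

/-- The three imaginary units. -/
def imUnit : Fin 3 → ℍ[ℝ] := ![i₁, i₂, i₃]

/-- The imaginary quaternion with given coordinates. -/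
noncomputable def imEmbed : EuclideanSpace ℝ (Fin 3) →L[ℝ] ℍ[ℝ] :=
  ∑ m, (EuclideanSpace.proj m : EuclideanSpace ℝ (Fin 3) →L[ℝ] ℝ).smulRight (imUnit m)

@[simp] theorem i₁_re : i₁.re = 0 := rfl
@[simp] theorem i₁_imI : i₁.imI = 1 := rfl
@[simp] theorem i₁_imJ : i₁.imJ = 0 := rfl
@[simp] theorem i₁_imK : i₁.imK = 0 := rfl
@[simp] theorem i₂_re : i₂.re = 0 := rfl
@[simp] theorem i₂_imI : i₂.imI = 0 := rfl
@[simp] theorem i₂_imJ : i₂.imJ = 1 := rfl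
@[simp] theorem i₂_imK : i₂.imK = 0 := rfl
@[simp] theorem i₃_re : i₃.re = 0 := rfl
@[simp] theorem i₃_imI : i₃.imI = 0 := rfl
@[simp] theorem i₃_imJ : i₃.imJ = 0 := rfl
@[simp] theorem i₃_imK : i₃.imK = 1 := rfl

theorem imEmbed_apply (t : EuclideanSpace ℝ (Fin 3)) :
    imEmbed t = t 0 • i₁ + t 1 • i₂ + t 2 • i₃ := by
  simp [imEmbed, Fin.sum_univ_three, imUnit]

theorem imEmbed_single (m : Fin 3) : imEmbed (EuclideanSpace.single m 1) = imUnit m := by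
  rw [imEmbed_apply]
  fin_cases m <;> simp [imUnit]

/-- Coordinates on `ℍ × ℍ` consisting of the height above the boundary of the Siegel half space
and the coordinates of the projection to the boundary. -/
noncomputable def siegelCoord (s : ℝ) (p : ℍ[ℝ] × EuclideanSpace ℝ (Fin 3)) : ℍ[ℝ] × ℍ[ℝ] :=
  (p.1, (‖p.1‖ ^ 2 + s) • (1 : ℍ[ℝ]) + imEmbed p.2)

theorem boundaryParam_add_vert (s : ℝ) (p : ℍ[ℝ] × EuclideanSpace ℝ (Fin 3)) :
    (boundaryParam p : ℍ[ℝ] × ℍ[ℝ]) + s • vert = siegelCoord s p := by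
  have h : (boundaryParam p : ℍ[ℝ] × ℍ[ℝ]).2
      = (‖p.1‖ ^ 2) • (1 : ℍ[ℝ]) + (p.2 0 • i₁ + p.2 1 • i₂ + p.2 2 • i₃) := by
    ext <;> simp [boundaryParam]
  refine Prod.ext (by simp [vert, siegelCoord, boundaryParam]) ?_
  simp only [Prod.snd_add, Prod.smul_snd, h, siegelCoord, vert, imEmbed_apply, add_smul]
  abel

theorem boundaryTranslate_boundaryParam (F : ℍ[ℝ] × ℍ[ℝ] → ℍ[ℝ]) (s : ℝ)
    (p : ℍ[ℝ] × EuclideanSpace ℝ (Fin 3)) :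
    boundaryTranslate F s (boundaryParam p) = F (siegelCoord s p) := by
  rw [boundaryTranslate, boundaryParam_add_vert]

theorem siegelCoord_snd_re (s : ℝ) (p : ℍ[ℝ] × EuclideanSpace ℝ (Fin 3)) :
    (siegelCoord s p).2.re = ‖p.1‖ ^ 2 + s := by
  simp [siegelCoord, imEmbed_apply]

theorem siegelCoord_mem {s : ℝ} (hs : 0 < s) (p : ℍ[ℝ] × EuclideanSpace ℝ (Fin 3)) :
    siegelCoord s p ∈ siegel := by
  have : (siegelCoord s p).1 = p.1 := rfl
  simp only [siegel, Set.mem_ofPred_eq, siegelCoord_snd_re, this]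
  linarith

theorem contDiff_siegelCoord :
    ContDiff ℝ ∞ fun z : ℝ × (ℍ[ℝ] × EuclideanSpace ℝ (Fin 3)) => siegelCoord z.1 z.2 := by
  unfold siegelCoord
  have h : ContDiff ℝ ∞ fun z : ℝ × (ℍ[ℝ] × EuclideanSpace ℝ (Fin 3)) => ‖z.2.1‖ ^ 2 :=
    (contDiff_fst.comp contDiff_snd).norm_sq ℝ
  fun_prop

theorem isOpen_siegel : IsOpen siegel :=
  isOpen_lt (by fun_prop) (Quaternion.continuous_re.comp continuous_snd)

/-- The height and t enter `siegelCoord` affinely, although w enters quadratically. Derivatives in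
these directions are therefore line derivatives of `F`, with no correction from the curvature of the
boundary. -/
theorem siegelCoord_add_time (s r : ℝ) (p : ℍ[ℝ] × EuclideanSpace ℝ (Fin 3)) :
    siegelCoord (s + r) p = siegelCoord s p + r • ((0, 1) : ℍ[ℝ] × ℍ[ℝ]) := by
  ext1 <;> simp [siegelCoord, add_smul]
  abel

theorem siegelCoord_add_im (s r : ℝ) (p : ℍ[ℝ] × EuclideanSpace ℝ (Fin 3)) (m : Fin 3) :
    siegelCoord s (p + r • (0, EuclideanSpace.single m 1))
      = siegelCoord s p + r • ((0, imUnit m) : ℍ[ℝ] × ℍ[ℝ]) := by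
  ext1 <;> simp [siegelCoord, imEmbed_single]
  abel

/-! ### The Cauchy-Riemann-Fueter equation in terms of the total derivative -/

variable {F : ℍ[ℝ] × ℍ[ℝ] → ℍ[ℝ]} {U : Set (ℍ[ℝ] × ℍ[ℝ])}

theorem QuaternionSiegel.QHolomorphicOn.differentiableAt (h : QHolomorphicOn F U) (hU : IsOpen U)
    {q : ℍ[ℝ] × ℍ[ℝ]} (hq : q ∈ U) : DifferentiableAt ℝ F q :=
  (h.1.differentiableOn (by simp)).differentiableAt (hU.mem_nhds hq)

theorem dbarLeft_snd_eq {q : ℍ[ℝ] × ℍ[ℝ]} (h : DifferentiableAt ℝ F q) :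
    dbarLeft (fun y => F (q.1, y)) q.2 = (1 / 2 : ℝ) • (fderiv ℝ F q (0, 1)
      + i₁ * fderiv ℝ F q (0, i₁) + i₂ * fderiv ℝ F q (0, i₂) + i₃ * fderiv ℝ F q (0, i₃)) := by
  have : HasFDerivAt (fun y => F (q.1, y))
      ((fderiv ℝ F q).comp (ContinuousLinearMap.inr ℝ ℍ[ℝ] ℍ[ℝ])) q.2 :=
    HasFDerivAt.comp q.2 (g := F) (f := fun y => (q.1, y)) h.hasFDerivAt
      (hasFDerivAt_prodMk_right q.1 q.2)
  simp [dbarLeft, this.fderiv]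

theorem dbarLeft_fst_eq {q : ℍ[ℝ] × ℍ[ℝ]} (h : DifferentiableAt ℝ F q) :
    dbarLeft (fun x => F (x, q.2)) q.1 = (1 / 2 : ℝ) • (fderiv ℝ F q (1, 0)
      + i₁ * fderiv ℝ F q (i₁, 0) + i₂ * fderiv ℝ F q (i₂, 0) + i₃ * fderiv ℝ F q (i₃, 0)) := by
  have : HasFDerivAt (fun x => F (x, q.2))
      ((fderiv ℝ F q).comp (ContinuousLinearMap.inl ℝ ℍ[ℝ] ℍ[ℝ])) q.1 :=
    HasFDerivAt.comp q.1 (g := F) (f := fun x => (x, q.2)) h.hasFDerivAt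
      (hasFDerivAt_prodMk_left q.1 q.2)
  simp [dbarLeft, this.fderiv]

/-- Solved for the vertical derivative, the equation in q₂ becomes an evolution equation in the
height: the directions on the right are tangent to the translates of the boundary. -/
theorem QuaternionSiegel.QHolomorphicOn.fderiv_vert (h : QHolomorphicOn F U) (hU : IsOpen U)
    {q : ℍ[ℝ] × ℍ[ℝ]} (hq : q ∈ U) :
    fderiv ℝ F q (0, 1) = -∑ m, imUnit m * fderiv ℝ F q (0, imUnit m) := by
  have := (h.2 q hq).2
  rw [dbarLeft_snd_eq (h.differentiableAt hU hq), smul_eq_zero_iff_right (by norm_num)] at this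
  rw [Fin.sum_univ_three, eq_neg_iff_add_eq_zero]
  simpa only [imUnit, Matrix.cons_val_zero, Matrix.cons_val_one, Matrix.cons_val, add_assoc]
    using this

/-- Together with the sign from integrating by parts in t_m, this skewness makes i_m ∂/∂t_m
symmetric. -/
theorem inner_imUnit_mul (m : Fin 3) (x y : ℍ[ℝ]) :
    inner ℝ (imUnit m * x) y = -inner ℝ x (imUnit m * y) := by
  fin_cases m <;> simp [imUnit, Quaternion.inner_def] <;> ring

theorem norm_imUnit (m : Fin 3) : ‖imUnit m‖ = 1 := by
  have : ‖imUnit m‖ * ‖imUnit m‖ = 1 := by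
    rw [← Quaternion.normSq_eq_norm_mul_self]
    fin_cases m <;> simp [imUnit, Quaternion.normSq_def']
  nlinarith [norm_nonneg (imUnit m)]

/-! ### Inner products of vertical translates -/

/-- A cut-off version of the derivative in `r` of `⟪F_{a+r}, F_{b-r}⟫` is, after an integration by
parts, controlled by the derivative of the cut-off function. -/
theorem abs_integral_cutoff_le (hF : QHolomorphicOn F siegel)
    {χ : ℍ[ℝ] × EuclideanSpace ℝ (Fin 3) → ℝ}
    (hχ : ContDiff ℝ ∞ χ) (hc : HasCompactSupport χ) {κ M : ℝ}
    (hκ : ∀ p m, |fderiv ℝ χ p (0, EuclideanSpace.single m 1)| ≤ κ)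
    {a b : ℝ} (ha : 0 < a) (hb : 0 < b)
    (hFa : MemLp (fun p => F (siegelCoord a p)) 2) (hFb : MemLp (fun p => F (siegelCoord b p)) 2)
    (hMa : ∫ p, ‖F (siegelCoord a p)‖ ^ 2 ≤ M) (hMb : ∫ p, ‖F (siegelCoord b p)‖ ^ 2 ≤ M) :
    |∫ p, χ p * (inner ℝ (fderiv ℝ F (siegelCoord a p) (0, 1)) (F (siegelCoord b p))
      - inner ℝ (F (siegelCoord a p)) (fderiv ℝ F (siegelCoord b p) (0, 1)))| ≤ 3 * (κ * M) := by
  have hsm : ∀ {s}, 0 < s → ContDiff ℝ ∞ fun p => F (siegelCoord s p) := fun {s} hs => by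
    refine contDiff_iff_contDiffAt.2 fun p => ?_
    exact (hF.1.contDiffAt (isOpen_siegel.mem_nhds (siegelCoord_mem hs p))).comp p
      (contDiff_siegelCoord.comp (contDiff_const.prodMk contDiff_id)).contDiffAt
  have hfd : ∀ {s} (hs : 0 < s) p m, fderiv ℝ (fun p => F (siegelCoord s p)) p
      (0, EuclideanSpace.single m 1) = fderiv ℝ F (siegelCoord s p) (0, imUnit m) := by
    intro s hs p m
    have h1 := (((hsm hs).differentiable (by simp)) p).hasFDerivAt.hasLineDerivAt
      (0, EuclideanSpace.single m 1)
    have h2 := (hF.differentiableAt isOpen_siegel (siegelCoord_mem hs p)).hasFDerivAt.hasLineDerivAt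
      (0, imUnit m)
    simp only [HasLineDerivAt, siegelCoord_add_im] at h1 h2
    exact h1.unique h2
  set A := fun p => F (siegelCoord a p) with hA
  set B := fun p => F (siegelCoord b p) with hB
  -- The integrand is minus the divergence in t of `θ`, up to the terms `ρ` in which the derivative
  -- falls on the cut-off.
  let θ : Fin 3 → ℍ[ℝ] × EuclideanSpace ℝ (Fin 3) → ℝ :=
    fun m p => χ p * inner ℝ (imUnit m * A p) (B p)
  let ρ : Fin 3 → ℍ[ℝ] × EuclideanSpace ℝ (Fin 3) → ℝ := fun m p =>
    fderiv ℝ χ p (0, EuclideanSpace.single m 1) * inner ℝ (imUnit m * A p) (B p)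
  have hsmA : ContDiff ℝ ∞ A := hsm ha
  have hsmB : ContDiff ℝ ∞ B := hsm hb
  have hin : ∀ m, ContDiff ℝ ∞ fun p => (inner ℝ (imUnit m * A p) (B p) : ℝ) := fun m =>
    (contDiff_const.mul hsmA).inner ℝ hsmB
  have hθ : ∀ m, ContDiff ℝ ∞ (θ m) := fun m => hχ.mul (hin m)
  have hθc : ∀ m, HasCompactSupport (θ m) := fun m => hc.mul_right
  have hθd : ∀ m p, fderiv ℝ (θ m) p (0, EuclideanSpace.single m 1) = ρ m p
      + χ p * (inner ℝ (imUnit m * fderiv ℝ F (siegelCoord a p) (0, imUnit m)) (B p)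
        - inner ℝ (A p) (imUnit m * fderiv ℝ F (siegelCoord b p) (0, imUnit m))) := by
    intro m p
    have dA : DifferentiableAt ℝ A p := hsmA.differentiable (by simp) p
    have dB : DifferentiableAt ℝ B p := hsmB.differentiable (by simp) p
    have h1 := ((hχ.differentiable (by simp) p).hasFDerivAt.mul
      ((dA.hasFDerivAt.const_mul (imUnit m)).inner ℝ dB.hasFDerivAt))
    have h2 : θ m = χ * fun p => inner ℝ (imUnit m * A p) (B p) := rfl
    rw [h2, h1.fderiv]
    simp only [_root_.add_apply, _root_.smul_apply,
      ContinuousLinearMap.comp_apply, fderivInnerCLM_apply, ContinuousLinearMap.prod_apply,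
      hA, hB, hfd ha, hfd hb, ρ, smul_eq_mul, inner_imUnit_mul]
    ring
  have hρi : ∀ m, Integrable (ρ m) := fun m => by
    refine Continuous.integrable_of_hasCompactSupport
      (((hχ.continuous_fderiv (by simp)).clm_apply continuous_const).mul (hin m).continuous) ?_
    exact (hc.fderiv_apply (𝕜 := ℝ) _).mul_right
  have hθi : ∀ m, Integrable fun p => fderiv ℝ (θ m) p (0, EuclideanSpace.single m 1) := fun m =>
    Continuous.integrable_of_hasCompactSupport
      (((hθ m).continuous_fderiv (by simp)).clm_apply continuous_const)
      ((hθc m).fderiv_apply (𝕜 := ℝ) _)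
  have key : ∀ p, χ p * (inner ℝ (fderiv ℝ F (siegelCoord a p) (0, 1)) (B p)
      - inner ℝ (A p) (fderiv ℝ F (siegelCoord b p) (0, 1)))
      = ∑ m, (ρ m p - fderiv ℝ (θ m) p (0, EuclideanSpace.single m 1)) := by
    intro p
    rw [hF.fderiv_vert isOpen_siegel (siegelCoord_mem ha p),
      hF.fderiv_vert isOpen_siegel (siegelCoord_mem hb p)]
    simp only [hθd, inner_neg_left, inner_neg_right, inner_add_left, inner_add_right,
      Fin.sum_univ_three]
    ring
  have h0 : ∀ m, ∫ p, fderiv ℝ (θ m) p (0, EuclideanSpace.single m 1) = 0 := fun m =>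
    integral_fderiv_apply_eq_zero ((hθ m).of_le (by simp)) (hθc m) _
  have hA2 : Integrable fun p => ‖A p‖ ^ 2 := (memLp_two_iff_integrable_sq_norm hFa.1).1 hFa
  have hB2 : Integrable fun p => ‖B p‖ ^ 2 := (memLp_two_iff_integrable_sq_norm hFb.1).1 hFb
  have hρ : ∀ m, |∫ p, ρ m p| ≤ κ * M := by
    intro m
    have hκ0 : 0 ≤ κ := (abs_nonneg _).trans (hκ 0 m)
    calc |∫ p, ρ m p| ≤ ∫ p, κ * ((‖A p‖ ^ 2 + ‖B p‖ ^ 2) / 2) := by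
          rw [← Real.norm_eq_abs]
          refine norm_integral_le_of_norm_le (((hA2.add hB2).div_const 2).const_mul κ)
            (.of_forall fun p => ?_)
          rw [Real.norm_eq_abs, abs_mul]
          refine mul_le_mul (hκ p m) ?_ (abs_nonneg _) hκ0
          refine (abs_real_inner_le_norm _ _).trans ?_
          rw [norm_mul, norm_imUnit]
          nlinarith [sq_nonneg (‖A p‖ - ‖B p‖)]
      _ = κ * ((∫ p, ‖A p‖ ^ 2) + ∫ p, ‖B p‖ ^ 2) / 2 := by
          rw [integral_const_mul, integral_div, integral_add hA2 hB2]; ring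
      _ ≤ κ * M := by nlinarith
  refine le_of_eq_of_le (congrArg _ (integral_congr_ae (.of_forall key))) ?_
  have hi : ∀ m, Integrable
      fun p => ρ m p - fderiv ℝ (θ m) p (0, EuclideanSpace.single m 1) :=
    fun m => (hρi m).sub (hθi m)
  rw [integral_finsetSum _ fun m _ => hi m]
  simp_rw [integral_sub (hρi _) (hθi _), h0, sub_zero]
  refine (Finset.abs_sum_le_sum_abs _ _).trans ((Finset.sum_le_sum fun m _ => hρ m).trans ?_)
  simp

/-- Cut-off inner products of vertical translates with the same total height differ by a quantity
controlled by the derivative of the cut-off function. -/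
theorem abs_integral_cutoff_sub_le (hF : QHolomorphicOn F siegel)
    {χ : ℍ[ℝ] × EuclideanSpace ℝ (Fin 3) → ℝ}
    (hχ : ContDiff ℝ ∞ χ) (hc : HasCompactSupport χ) {κ M : ℝ}
    (hκ : ∀ p m, |fderiv ℝ χ p (0, EuclideanSpace.single m 1)| ≤ κ)
    (hL : ∀ s, 0 < s → MemLp (fun p => F (siegelCoord s p)) 2)
    (hM : ∀ s, 0 < s → ∫ p, ‖F (siegelCoord s p)‖ ^ 2 ≤ M)
    {a b c d : ℝ} (ha : 0 < a) (hb : 0 < b) (hc0 : 0 < c) (hd : 0 < d) (h : a + b = c + d) :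
    |(∫ p, χ p * inner ℝ (F (siegelCoord c p)) (F (siegelCoord d p)))
      - ∫ p, χ p * inner ℝ (F (siegelCoord a p)) (F (siegelCoord b p))|
      ≤ 3 * (κ * M) * |c - a| := by
  -- The pair of heights slides from (a, b) at r = 0 to (c, d) at r = c - a; both heights stay
  -- positive exactly on this interval.
  have hder : ∀ r ∈ Set.Ioo (-a) b, HasDerivAt
      (fun r => ∫ p, χ p * inner ℝ (F (siegelCoord (a + r) p)) (F (siegelCoord (b - r) p)))
      (∫ p, χ p * (inner ℝ (fderiv ℝ F (siegelCoord (a + r) p) (0, 1)) (F (siegelCoord (b - r) p))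
      - inner ℝ (F (siegelCoord (a + r) p)) (fderiv ℝ F (siegelCoord (b - r) p) (0, 1)))) r := by
    intro r hr
    have hFc : ContinuousOn F siegel := hF.1.continuousOn
    have hFc' : ContinuousOn (fun q => fderiv ℝ F q (0, 1)) siegel :=
      (hF.1.continuousOn_fderiv_of_isOpen isOpen_siegel (by simp)).clm_apply continuousOn_const
    have hcont : Continuous fun z : ℝ × (ℍ[ℝ] × EuclideanSpace ℝ (Fin 3)) =>
      siegelCoord z.1 z.2 := contDiff_siegelCoord.continuous
    have m1 : Set.MapsTo (fun z : ℝ × (ℍ[ℝ] × EuclideanSpace ℝ (Fin 3)) =>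
        siegelCoord (a + z.1) z.2) (Set.Ioo (-a) b ×ˢ tsupport χ) siegel :=
      fun z hz => siegelCoord_mem (by linarith [hz.1.1]) _
    have m2 : Set.MapsTo (fun z : ℝ × (ℍ[ℝ] × EuclideanSpace ℝ (Fin 3)) =>
        siegelCoord (b - z.1) z.2) (Set.Ioo (-a) b ×ˢ tsupport χ) siegel :=
      fun z hz => siegelCoord_mem (by linarith [hz.1.2]) _
    have c1 : Continuous (fun z : ℝ × (ℍ[ℝ] × EuclideanSpace ℝ (Fin 3)) =>
        siegelCoord (a + z.1) z.2) :=
      hcont.comp (((continuous_const.add continuous_fst)).prodMk continuous_snd)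
    have c2 : Continuous (fun z : ℝ × (ℍ[ℝ] × EuclideanSpace ℝ (Fin 3)) =>
        siegelCoord (b - z.1) z.2) :=
      hcont.comp (((continuous_const.sub continuous_fst)).prodMk continuous_snd)
    have A1 := hFc.comp c1.continuousOn m1
    have A2 := hFc.comp c2.continuousOn m2
    have B1 := hFc'.comp c1.continuousOn m1
    have B2 := hFc'.comp c2.continuousOn m2
    have X : ContinuousOn (fun z : ℝ × (ℍ[ℝ] × EuclideanSpace ℝ (Fin 3)) => χ z.2)
      (Set.Ioo (-a) b ×ˢ tsupport χ) := (hχ.continuous.comp continuous_snd).continuousOn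
    refine hasDerivAt_integral_of_isCompact hc.isCompact isOpen_Ioo hr
      (f := fun r p => χ p * inner ℝ (F (siegelCoord (a + r) p)) (F (siegelCoord (b - r) p)))
      (f' := fun r p => χ p * (inner ℝ (fderiv ℝ F (siegelCoord (a + r) p) (0, 1))
        (F (siegelCoord (b - r) p))
      - inner ℝ (F (siegelCoord (a + r) p)) (fderiv ℝ F (siegelCoord (b - r) p) (0, 1))))
      (fun t x hx => by simp [image_eq_zero_of_notMem_tsupport hx])
      (fun t x hx => by simp [image_eq_zero_of_notMem_tsupport hx]) ?_ ?_ ?_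
    · intro t ht
      have := X.mul (A1.inner (𝕜 := ℝ) A2)
      exact this.comp (f := fun x => (t, x)) (by fun_prop) (fun x hx => ⟨ht, hx⟩)
    · exact X.mul ((B1.inner (𝕜 := ℝ) A2).sub (A1.inner (𝕜 := ℝ) B2))
    · intro t ht x _
      have d1 : HasDerivAt (fun t => F (siegelCoord (a + t) x))
          (fderiv ℝ F (siegelCoord (a + t) x) (0, 1)) t := by
        have h2 := (hF.differentiableAt isOpen_siegel (siegelCoord_mem (s := a + t)
          (by linarith [ht.1]) x)).hasFDerivAt.hasLineDerivAt (0, 1)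
        simp only [HasLineDerivAt, ← siegelCoord_add_time] at h2
        have h3 := h2.scomp_of_eq t ((hasDerivAt_id t).sub (hasDerivAt_const t t)) (by simp)
        simpa [Function.comp_def] using h3
      have d2 : HasDerivAt (fun t => F (siegelCoord (b - t) x))
          (-fderiv ℝ F (siegelCoord (b - t) x) (0, 1)) t := by
        have h2 := (hF.differentiableAt isOpen_siegel (siegelCoord_mem (s := b - t)
          (by linarith [ht.2]) x)).hasFDerivAt.hasLineDerivAt (0, 1)
        simp only [HasLineDerivAt, ← siegelCoord_add_time] at h2
        have h3 := h2.scomp_of_eq t ((hasDerivAt_const t t).sub (hasDerivAt_id t)) (by simp)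
        simpa [Function.comp_def] using h3
      have := (d1.inner ℝ d2).const_mul (χ x)
      exact this.congr_deriv (by rw [inner_neg_right]; ring)
  have hca : c - a ∈ Set.Ioo (-a) b := ⟨by linarith, by linarith⟩
  have h0 : (0 : ℝ) ∈ Set.Ioo (-a) b := ⟨by linarith, hb⟩
  have := (convex_Ioo (-a) b).norm_image_sub_le_of_norm_hasDerivWithin_le (C := 3 * (κ * M))
    (fun r hr => (hder r hr).hasDerivWithinAt) (fun r hr => ?_) h0 hca
  · have e1 : a + (c - a) = c := by ring
    have e2 : b - (c - a) = d := by linarith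
    simpa [e1, e2] using this
  · have h1 : 0 < a + r := by linarith [hr.1]
    have h2 : 0 < b - r := by linarith [hr.2]
    exact abs_integral_cutoff_le hF hχ hc hκ h1 h2 (hL _ h1) (hL _ h2) (hM _ h1) (hM _ h2)

end

/-! ### Removing the cut-off -/

section

variable {F : ℍ[ℝ] × ℍ[ℝ] → ℍ[ℝ]}

/-- Smooth cut-off functions converging to `1` whose derivatives converge uniformly to `0`. -/
theorem exists_cutoff_seq (E : Type*) [NormedAddCommGroup E] [NormedSpace ℝ E]
    [FiniteDimensional ℝ E] : ∃ (χ : ℕ → E → ℝ) (K : ℝ), (∀ n, ContDiff ℝ ∞ (χ n)) ∧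
      (∀ n, HasCompactSupport (χ n)) ∧ (∀ n p, 0 ≤ χ n p) ∧ (∀ n p, χ n p ≤ 1) ∧
      (∀ p, Tendsto (fun n => χ n p) atTop (𝓝 1)) ∧
      ∀ n p, ‖fderiv ℝ (χ n) p‖ ≤ K * (1 / ((n : ℝ) + 1)) := by
  let f : ContDiffBump (0 : E) := ⟨1, 2, by norm_num, by norm_num⟩
  have hfs : ContDiff ℝ ∞ f := f.contDiff
  obtain ⟨K, hK⟩ := (f.hasCompactSupport.fderiv (𝕜 := ℝ)).exists_bound_of_continuous
    (hfs.continuous_fderiv (by simp))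
  refine ⟨fun n p => f ((1 / ((n : ℝ) + 1)) • p), K, fun n => hfs.comp (contDiff_const_smul _),
    fun n => f.hasCompactSupport.comp_smul (by positivity), fun _ _ => f.nonneg,
    fun _ _ => f.le_one, fun p => ?_, fun n p => ?_⟩
  · have h1 := (tendsto_one_div_add_atTop_nhds_zero_nat (𝕜 := ℝ)).smul_const p
    rw [zero_smul] at h1
    have h3 := (hfs.continuous.tendsto 0).comp h1
    rwa [f.one_of_mem_closedBall (by simpa using f.rIn_pos.le)] at h3
  · rw [fderiv_comp_smul, norm_smul, Real.norm_eq_abs, abs_of_nonneg (by positivity), mul_comm]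
    exact mul_le_mul_of_nonneg_right (hK _) (by positivity)

theorem MeasureTheory.MemLp.integrable_real_inner {α E : Type*} [MeasurableSpace α] {μ : Measure α}
    [NormedAddCommGroup E] [InnerProductSpace ℝ E] {f g : α → E} (hf : MemLp f 2 μ)
    (hg : MemLp g 2 μ) : Integrable (fun x => (inner ℝ (f x) (g x) : ℝ)) μ := by
  refine (hf.norm.integrable_mul hg.norm).mono' (hf.1.inner hg.1) (.of_forall fun x => ?_)
  exact norm_inner_le_norm _ _

/-- The inner product of two vertical translates depends only on the sum of their heights. -/
theorem integral_inner_siegelCoord_eq (hF : QHolomorphicOn F siegel) {M : ℝ}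
    (hL : ∀ s, 0 < s → MemLp (fun p => F (siegelCoord s p)) 2)
    (hM : ∀ s, 0 < s → ∫ p, ‖F (siegelCoord s p)‖ ^ 2 ≤ M)
    {a b c d : ℝ} (ha : 0 < a) (hb : 0 < b) (hc : 0 < c) (hd : 0 < d) (h : a + b = c + d) :
    ∫ p, (inner ℝ (F (siegelCoord a p)) (F (siegelCoord b p)) : ℝ)
      = ∫ p, inner ℝ (F (siegelCoord c p)) (F (siegelCoord d p)) := by
  obtain ⟨χ, K, hχ, hχc, h0, h1, hχ1, hK⟩ := exists_cutoff_seq (ℍ[ℝ] × EuclideanSpace ℝ (Fin 3))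
  have hκ : ∀ n p m, |fderiv ℝ (χ n) p (0, EuclideanSpace.single m 1)|
      ≤ K * (1 / ((n : ℝ) + 1)) := by
    intro n p m
    have h2 := (fderiv ℝ (χ n) p).le_opNorm (0, EuclideanSpace.single m 1)
    have h3 : ‖((0, EuclideanSpace.single m 1) : ℍ[ℝ] × EuclideanSpace ℝ (Fin 3))‖ = 1 := by
      simp [Prod.norm_def]
    rw [h3, mul_one] at h2
    exact h2.trans (hK n p)
  have hlim : ∀ a b, 0 < a → 0 < b → Tendsto
      (fun n => ∫ p, χ n p * inner ℝ (F (siegelCoord a p)) (F (siegelCoord b p))) atTop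
      (𝓝 (∫ p, (inner ℝ (F (siegelCoord a p)) (F (siegelCoord b p)) : ℝ))) := by
    intro a b ha hb
    have hi : Integrable fun p => (inner ℝ (F (siegelCoord a p)) (F (siegelCoord b p)) : ℝ) :=
      (hL a ha).integrable_real_inner (hL b hb)
    refine tendsto_integral_of_dominated_convergence _
      (fun n => (hχ n).continuous.aestronglyMeasurable.mul hi.aestronglyMeasurable) hi.norm
      (fun n => .of_forall fun p => ?_) (.of_forall fun p => ?_)
    · rw [norm_mul, Real.norm_eq_abs, abs_of_nonneg (h0 _ _)]
      exact mul_le_of_le_one_left (norm_nonneg _) (h1 _ _)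
    · simpa using (hχ1 p).mul_const (inner ℝ (F (siegelCoord a p)) (F (siegelCoord b p)))
  -- The cut-off error is 3κM|c - a| with κ = K/(n + 1), which tends to 0.
  have hle : |_ - _| ≤ _ := le_of_tendsto_of_tendsto'
    ((hlim c d hc hd).sub (hlim a b ha hb)).abs
    ((tendsto_one_div_add_atTop_nhds_zero_nat (𝕜 := ℝ)).const_mul (3 * (K * M) * |c - a|))
    (fun n => (abs_integral_cutoff_sub_le hF (hχ n) (hχc n) (hκ n) hL hM ha hb hc hd h).trans
      (le_of_eq (by ring)))
  rw [mul_zero] at hle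
  exact (sub_eq_zero.1 (abs_nonpos_iff.1 hle)).symm

/-! ### Existence of boundary values -/

theorem eLpNorm_two_sq {α E : Type*} [MeasurableSpace α] {μ : Measure α} [NormedAddCommGroup E]
    (f : α → E) : eLpNorm f 2 μ ^ 2 = ∫⁻ x, ‖f x‖ₑ ^ 2 ∂μ := by
  have := eLpNorm_nnreal_pow_eq_lintegral (p := 2) (f := f) (μ := μ) (by norm_num)
  simpa using this

theorem hardySup_eq (F : ℍ[ℝ] × ℍ[ℝ] → ℍ[ℝ]) :
    hardySup F = ⨆ (ε : ℝ) (_ : 0 < ε), eLpNorm (boundaryTranslate F ε) 2 beta ^ 2 := by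
  simp only [hardySup, eLpNorm_two_sq]

theorem eLpNorm_sq_le_hardySup (F : ℍ[ℝ] × ℍ[ℝ] → ℍ[ℝ]) {s : ℝ} (hs : 0 < s) :
    eLpNorm (boundaryTranslate F s) 2 beta ^ 2 ≤ hardySup F := by
  rw [hardySup_eq]
  exact le_iSup₂ (f := fun s (_ : 0 < s) => eLpNorm (boundaryTranslate F s) 2 beta ^ 2) s hs

theorem hardySup_le {C : ℝ≥0∞}
    (h : ∀ s, 0 < s → eLpNorm (boundaryTranslate F s) 2 beta ≤ C) : hardySup F ≤ C ^ 2 := by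
  rw [hardySup_eq]
  exact iSup₂_le fun s hs => pow_le_pow_left' (h s hs) 2

theorem mem_siegel_of_mem_boundary {s : ℝ} (hs : 0 < s) (q : siegelBoundary) :
    (q : ℍ[ℝ] × ℍ[ℝ]) + s • vert ∈ siegel := by
  have h : (q : ℍ[ℝ] × ℍ[ℝ]).2.re = ‖(q : ℍ[ℝ] × ℍ[ℝ]).1‖ ^ 2 := q.2
  simp [siegel, vert, h, hs]

theorem ContinuousOn.continuous_boundaryTranslate (hF : ContinuousOn F siegel) {s : ℝ}
    (hs : 0 < s) : Continuous (boundaryTranslate F s) :=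
  hF.comp_continuous (by fun_prop) (mem_siegel_of_mem_boundary hs)

theorem ContinuousOn.aestronglyMeasurable_boundaryTranslate (hF : ContinuousOn F siegel) {s : ℝ}
    (hs : 0 < s) : AEStronglyMeasurable (boundaryTranslate F s) beta :=
  (hF.continuous_boundaryTranslate hs).aestronglyMeasurable

theorem QuaternionSiegel.MemHardy.memLp (hF : MemHardy F) {s : ℝ} (hs : 0 < s) :
    MemLp (boundaryTranslate F s) 2 beta := by
  refine ⟨hF.1.1.continuousOn.aestronglyMeasurable_boundaryTranslate hs, ?_⟩
  have h := (eLpNorm_sq_le_hardySup F hs).trans_lt hF.2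
  exact lt_top_iff_ne_top.2 fun htop => by simp [htop] at h

/-- The vertical translates as a curve in `L²`. -/
noncomputable def QuaternionSiegel.MemHardy.curve (hF : MemHardy F) (s : ℝ) : Lp ℍ[ℝ] 2 beta :=
  if hs : 0 < s then (hF.memLp hs).toLp _ else 0

theorem QuaternionSiegel.MemHardy.coeFn_curve (hF : MemHardy F) {s : ℝ} (hs : 0 < s) :
    hF.curve s =ᵐ[beta] boundaryTranslate F s := by
  rw [MemHardy.curve, dif_pos hs]
  exact MemLp.coeFn_toLp _

theorem QuaternionSiegel.MemHardy.enorm_curve (hF : MemHardy F) {s : ℝ} (hs : 0 < s) :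
    ‖hF.curve s‖ₑ = eLpNorm (boundaryTranslate F s) 2 beta := by
  rw [Lp.enorm_def, eLpNorm_congr_ae (hF.coeFn_curve hs)]

theorem isBoundaryValue_iff_tendsto (hF : MemHardy F) (G : Lp ℍ[ℝ] 2 beta) :
    IsBoundaryValue F G ↔ Tendsto hF.curve (𝓝[>] 0) (𝓝 G) := by
  rw [tendsto_iff_edist_tendsto_0, IsBoundaryValue]
  refine tendsto_congr' ?_
  filter_upwards [self_mem_nhdsWithin] with s hs
  rw [Lp.edist_def]
  refine eLpNorm_congr_ae ?_
  filter_upwards [hF.coeFn_curve hs] with q hq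
  simp [hq]

theorem inner_curve (hF : MemHardy F) {a b : ℝ} (ha : 0 < a) (hb : 0 < b) :
    inner ℝ (hF.curve a) (hF.curve b)
      = ∫ p, (inner ℝ (F (siegelCoord a p)) (F (siegelCoord b p)) : ℝ) := by
  have hc := hF.1.1.continuousOn
  have h1 : inner ℝ (hF.curve a) (hF.curve b)
      = ∫ q, (inner ℝ (boundaryTranslate F a q) (boundaryTranslate F b q) : ℝ) ∂beta := by
    rw [L2.inner_def]
    refine integral_congr_ae ?_
    filter_upwards [hF.coeFn_curve ha, hF.coeFn_curve hb] with q h1 h2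
    rw [h1, h2]
  rw [h1, beta, integral_map measurable_boundaryParam.aemeasurable]
  · simp only [boundaryTranslate_boundaryParam]
  · exact ((hc.continuous_boundaryTranslate ha).inner
      (hc.continuous_boundaryTranslate hb)).aestronglyMeasurable

/-- A function in the Hardy space has a boundary value, which dominates its vertical
translates. -/
theorem QuaternionSiegel.MemHardy.exists_tendsto_curve (hF : MemHardy F) :
    ∃ G, Tendsto hF.curve (𝓝[>] 0) (𝓝 G) ∧ ∀ s, 0 < s → ‖hF.curve s‖ ≤ ‖G‖ := by
  have hC : ∀ s, 0 < s → ‖hF.curve s‖ ≤ hardyNorm F := by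
    intro s hs
    refine Real.le_sqrt_of_sq_le ?_
    have h := ENNReal.toReal_mono hF.2.ne (eLpNorm_sq_le_hardySup F hs)
    rwa [ENNReal.toReal_pow, ← hF.enorm_curve hs, toReal_enorm] at h
  refine exists_tendsto_of_inner_eq_of_add_eq (C := hardyNorm F) ?_ hC
  intro a b c d ha hb hc hd h
  rw [inner_curve hF ha hb, inner_curve hF hc hd]
  refine integral_inner_siegelCoord_eq hF.1 (M := hardyNorm F ^ 2) (fun s hs => ?_)
    (fun s hs => ?_) ha hb hc hd h
  · have := hF.memLp hs
    rw [beta, memLp_map_measure_iff (hF.memLp hs).1 measurable_boundaryParam.aemeasurable] at this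
    simpa only [Function.comp_def, boundaryTranslate_boundaryParam] using this
  · have h1 := inner_curve hF hs hs
    simp only [real_inner_self_eq_norm_sq] at h1
    rw [← h1]
    have := hC s hs
    gcongr

/-! ### Uniqueness of the boundary value and the isometry -/

theorem QuaternionSiegel.IsBoundaryValue.unique (hF : MemHardy F) {G G' : Lp ℍ[ℝ] 2 beta}
    (hG : IsBoundaryValue F G) (hG' : IsBoundaryValue F G') : G = G' :=
  tendsto_nhds_unique ((isBoundaryValue_iff_tendsto hF G).1 hG)
    ((isBoundaryValue_iff_tendsto hF G').1 hG')

theorem QuaternionSiegel.MemHardy.exists_isBoundaryValue (hF : MemHardy F) :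
    ∃ G, IsBoundaryValue F G :=
  hF.exists_tendsto_curve.imp fun G hG => (isBoundaryValue_iff_tendsto hF G).2 hG.1

theorem QuaternionSiegel.IsBoundaryValue.eLpNorm_le (hF : MemHardy F) {G : Lp ℍ[ℝ] 2 beta}
    (hG : IsBoundaryValue F G) {s : ℝ} (hs : 0 < s) :
    eLpNorm (boundaryTranslate F s) 2 beta ≤ ‖G‖ₑ := by
  obtain ⟨G', hG', hle⟩ := hF.exists_tendsto_curve
  obtain rfl := hG.unique hF ((isBoundaryValue_iff_tendsto hF G').2 hG')
  rw [← hF.enorm_curve hs]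
  exact enorm_le_iff_norm_le.2 (hle s hs)

/-- One inequality is the domination of the translates by their limit, the other is continuity of
the norm along the convergent curve. -/
theorem QuaternionSiegel.IsBoundaryValue.hardySup_eq (hF : MemHardy F) {G : Lp ℍ[ℝ] 2 beta}
    (hG : IsBoundaryValue F G) : hardySup F = ‖G‖ₑ ^ 2 := by
  refine le_antisymm (hardySup_le fun s hs => hG.eLpNorm_le hF hs) ?_
  have h := ((isBoundaryValue_iff_tendsto hF G).1 hG).enorm
  refine le_of_tendsto (ENNReal.Tendsto.pow (n := 2) h) ?_
  filter_upwards [self_mem_nhdsWithin] with s hs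
  rw [hF.enorm_curve hs]
  exact eLpNorm_sq_le_hardySup F hs

theorem QuaternionSiegel.IsBoundaryValue.norm_eq (hF : MemHardy F) {G : Lp ℍ[ℝ] 2 beta}
    (hG : IsBoundaryValue F G) : ‖G‖ = hardyNorm F := by
  rw [hardyNorm, hG.hardySup_eq hF, ENNReal.toReal_pow, toReal_enorm,
    Real.sqrt_sq (norm_nonneg _)]

end

section

/-! ### A mean value property of regular functions of one quaternionic variable -/

/-- The standard orthonormal basis of the quaternions. -/
def quatUnit : Fin 4 → ℍ[ℝ] := ![1, i₁, i₂, i₃]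

theorem dbarLeft_eq_sum (f : ℍ[ℝ] → ℍ[ℝ]) (p : ℍ[ℝ]) :
    dbarLeft f p = (1 / 2 : ℝ) • ∑ k, quatUnit k * fderiv ℝ f p (quatUnit k) := by
  simp [dbarLeft, Fin.sum_univ_four, quatUnit]

theorem sum_inner_smul_quatUnit (y : ℍ[ℝ]) :
    ∑ k, (inner ℝ (quatUnit k) y : ℝ) • quatUnit k = y := by
  ext <;> simp [Fin.sum_univ_four, quatUnit, Quaternion.inner_def]

theorem star_quatUnit_mul_self (k : Fin 4) : star (quatUnit k) * quatUnit k = 1 := by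
  fin_cases k <;> ext <;> simp [quatUnit]

/-- A smooth radial bump function on the quaternions, supported in the closed unit ball. -/
noncomputable def radialBump (y : ℍ[ℝ]) : ℝ := Real.smoothTransition (1 - ‖y‖ ^ 2)

theorem contDiff_radialBump : ContDiff ℝ ∞ radialBump :=
  Real.smoothTransition.contDiff.comp (contDiff_const.sub (contDiff_id.norm_sq ℝ))

theorem radialBump_neg (y : ℍ[ℝ]) : radialBump (-y) = radialBump y := by
  simp [radialBump]

theorem radialBump_nonneg (y : ℍ[ℝ]) : 0 ≤ radialBump y := Real.smoothTransition.nonneg _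

theorem tsupport_radialBump_subset : tsupport radialBump ⊆ Metric.closedBall 0 1 := by
  refine closure_minimal (fun y hy => ?_) Metric.isClosed_closedBall
  by_contra h
  rw [mem_closedBall_zero_iff, not_le] at h
  exact hy (Real.smoothTransition.zero_of_nonpos (by nlinarith))

theorem hasCompactSupport_radialBump : HasCompactSupport radialBump :=
  (isCompact_closedBall 0 1).of_isClosed_subset (isClosed_tsupport _) tsupport_radialBump_subset

/-- Only the direction of the gradient matters: it is parallel to y, and the factor is never needed.
-/
theorem fderiv_radialBump (y : ℍ[ℝ]) :
    ∃ c : ℝ, ∀ v, fderiv ℝ radialBump y v = c * inner ℝ v y := by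
  have h1 : HasFDerivAt (fun y : ℍ[ℝ] => 1 - ‖y‖ ^ 2) (-(2 • innerSL ℝ y)) y := by
    simpa using (hasFDerivAt_id y).norm_sq.const_sub 1
  have h2 := ((Real.smoothTransition.contDiff (n := 1)).differentiable one_ne_zero
    (1 - ‖y‖ ^ 2)).hasDerivAt.comp_hasFDerivAt y h1
  refine ⟨-2 * deriv Real.smoothTransition (1 - ‖y‖ ^ 2), fun v => ?_⟩
  have h3 : radialBump = Real.smoothTransition ∘ fun y => 1 - ‖y‖ ^ 2 := rfl
  rw [h3, h2.fderiv]
  simp [real_inner_comm v y]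
  ring

/-- The total mass of the radial bump function. -/
noncomputable def radialMass : ℝ := ∫ y, radialBump y

theorem radialMass_pos : 0 < radialMass :=
  contDiff_radialBump.continuous.integral_pos_of_hasCompactSupport_nonneg_nonzero
    hasCompactSupport_radialBump radialBump_nonneg (x := 0) (by simp [radialBump])

/-- The linear coefficients of the vector field whose divergence is the radial derivative. -/
noncomputable def radialField (k : Fin 4) : ℍ[ℝ] →L[ℝ] ℍ[ℝ] :=
  (innerSL ℝ (quatUnit k)).smulRight 1
    - (ContinuousLinearMap.mul ℝ ℍ[ℝ]).flip (quatUnit k) ∘L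
      ((2 • innerSL ℝ (1 : ℍ[ℝ])).smulRight 1 - ContinuousLinearMap.id ℝ ℍ[ℝ])

theorem radialField_apply (k : Fin 4) (y : ℍ[ℝ]) :
    radialField k y = (inner ℝ (quatUnit k) y : ℝ) • 1 - star y * quatUnit k := by
  have h : star y = (2 * inner ℝ 1 y : ℝ) • (1 : ℍ[ℝ]) - y := by
    ext <;> simp [Quaternion.inner_def]
    ring
  simp [radialField, h, sub_mul]

/-- The k-th coefficient is constant in the k-th direction, so the divergence has no term from
differentiating the coefficients. -/
theorem radialField_quatUnit (k : Fin 4) : radialField k (quatUnit k) = 0 := by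
  rw [radialField_apply, star_quatUnit_mul_self]
  rw [Quaternion.inner_def]
  fin_cases k <;> simp [quatUnit]

/-- The sum is |y|² minus the product of the conjugate of y with y. This kills the term of the
divergence in which the derivative falls on the radial weight. -/
theorem sum_inner_smul_radialField (y : ℍ[ℝ]) :
    ∑ k, (inner ℝ (quatUnit k) y : ℝ) • radialField k y = 0 := by
  simp_rw [radialField_apply, smul_sub, Finset.sum_sub_distrib, ← mul_smul_comm, ← Finset.mul_sum,
    sum_inner_smul_quatUnit, ← mul_smul, ← Finset.sum_smul]
  rw [Quaternion.star_mul_self]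
  ext <;> simp [Fin.sum_univ_four, quatUnit, Quaternion.inner_def, Quaternion.normSq_def', sq]

variable {f : ℍ[ℝ] → ℍ[ℝ]} {x : ℍ[ℝ]} {R : ℝ}

theorem add_smul_mem_ball {r : ℝ} (hr : |r| < R) {y : ℍ[ℝ]} (hy : ‖y‖ ≤ 1) :
    x + r • y ∈ Metric.ball x R := by
  rw [mem_ball_iff_norm, add_sub_cancel_left, norm_smul, Real.norm_eq_abs]
  exact lt_of_le_of_lt (mul_le_of_le_one_right (abs_nonneg _) hy) hr

/-- The weighted integral of the radial derivative of a regular function vanishes. -/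
theorem smul_integral_radialBump_fderiv (hf : ContDiffOn ℝ ∞ f (Metric.ball x R))
    (hd : ∀ y ∈ Metric.ball x R, dbarLeft f y = 0) {r : ℝ} (hr : |r| < R) :
    r • ∫ y, radialBump y • fderiv ℝ f (x + r • y) y = 0 := by
  -- With coefficients ⟨e_k, y⟩ - ȳ e_k, the divergence is r times the weighted radial derivative:
  -- the part carrying ȳ multiplies ∑ e_k ∂_k f = 0.
  let Ξ : Fin 4 → ℍ[ℝ] → ℍ[ℝ] := fun k y => radialBump y • (radialField k y * f (x + r • y))
  have hfat : ∀ y ∈ tsupport radialBump, ContDiffAt ℝ ∞ f (x + r • y) := fun y hy =>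
    hf.contDiffAt (Metric.isOpen_ball.mem_nhds (add_smul_mem_ball hr
      (by simpa using tsupport_radialBump_subset hy)))
  have hts : ∀ k, tsupport (Ξ k) ⊆ tsupport radialBump := fun k => tsupport_smul_subset_left _ _
  have hΞc : ∀ k, HasCompactSupport (Ξ k) := fun k => hasCompactSupport_radialBump.smul_right
  have hΞ : ∀ k, ContDiff ℝ ∞ (Ξ k) := by
    refine fun k => contDiff_iff_contDiffAt.2 fun y => ?_
    -- `f` is smooth only on the ball; away from the support the field is locally zero.
    by_cases hy : y ∈ tsupport (Ξ k)
    swap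
    · exact contDiffAt_const.congr_of_eventuallyEq (notMem_tsupport_iff_eventuallyEq.1 hy)
    refine contDiff_radialBump.contDiffAt.smul ((radialField k).contDiff.contDiffAt.mul ?_)
    exact (hfat y (hts k hy)).comp (f := fun y => x + r • y) y (by fun_prop)
  have hi : ∀ k, Integrable fun y => fderiv ℝ (Ξ k) y (quatUnit k) := fun k =>
    Continuous.integrable_of_hasCompactSupport
      (((hΞ k).continuous_fderiv (by simp)).clm_apply continuous_const)
      ((hΞc k).fderiv_apply (𝕜 := ℝ) _)
  have key : ∀ y, r • radialBump y • fderiv ℝ f (x + r • y) y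
      = ∑ k, fderiv ℝ (Ξ k) y (quatUnit k) := by
    intro y
    by_cases hy : y ∈ tsupport radialBump
    · set D := fderiv ℝ f (x + r • y) with hD
      have hfd : HasFDerivAt (fun y => f (x + r • y)) (r • D) y := by
        have h1 : HasFDerivAt (fun y : ℍ[ℝ] => x + r • y)
            (r • ContinuousLinearMap.id ℝ ℍ[ℝ]) y :=
          ((hasFDerivAt_id y).const_smul r).const_add x
        have h2 := ((hfat y hy).differentiableAt (by simp)).hasFDerivAt.comp y h1
        refine h2.congr_fderiv ?_
        ext1 v; simp [hD]
      obtain ⟨c, hc⟩ := fderiv_radialBump y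
      have hk : ∀ k, fderiv ℝ (Ξ k) y (quatUnit k)
          = r • radialBump y • (radialField k y * D (quatUnit k))
            + c • (((inner ℝ (quatUnit k) y : ℝ) • radialField k y) * f (x + r • y)) := by
        intro k
        have h1 := (contDiff_radialBump.differentiable (by simp) y).hasFDerivAt.smul
          ((radialField k).hasFDerivAt.mul' hfd)
        have h3 : HasFDerivAt (Ξ k) _ y := h1
        rw [h3.fderiv]
        simp [hc, radialField_quatUnit, mul_smul, smul_comm r]
      have hreg : ∑ k, quatUnit k * D (quatUnit k) = 0 := by
        have := hd (x + r • y) (add_smul_mem_ball hr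
          (by simpa using tsupport_radialBump_subset hy))
        rwa [dbarLeft_eq_sum, smul_eq_zero_iff_right (by norm_num)] at this
      have hDy : ∑ k, radialField k y * D (quatUnit k) = D y := by
        simp_rw [radialField_apply, sub_mul, Finset.sum_sub_distrib, mul_assoc, ← Finset.mul_sum,
          hreg, mul_zero, sub_zero, smul_mul_assoc, one_mul, ← map_smul, ← map_sum,
          sum_inner_smul_quatUnit]
      simp_rw [hk, Finset.sum_add_distrib, ← Finset.smul_sum, hDy, ← Finset.sum_mul,
        sum_inner_smul_radialField]
      simp
    · have h1 : ∀ k, fderiv ℝ (Ξ k) y = 0 := fun k =>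
        image_eq_zero_of_notMem_tsupport fun h => hy (hts k (tsupport_fderiv_subset ℝ h))
      simp [h1, image_eq_zero_of_notMem_tsupport hy]
  rw [← integral_smul]
  simp_rw [key]
  rw [integral_finsetSum _ fun k _ => hi k]
  exact Finset.sum_eq_zero fun k _ =>
    integral_fderiv_apply_eq_zero ((hΞ k).of_le (by simp)) (hΞc k) _

/-- Mean value property of regular functions with respect to a smooth radial weight. -/
theorem radialMass_smul_eq_integral (hf : ContDiffOn ℝ ∞ f (Metric.ball x R))
    (hd : ∀ y ∈ Metric.ball x R, dbarLeft f y = 0) {δ : ℝ} (hδ : |δ| < R) :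
    radialMass • f x = ∫ y, radialBump y • f (x + δ • y) := by
  have hder : ∀ r ∈ Set.Ioo (-R) R,
      HasDerivAt (fun r => ∫ y, radialBump y • f (x + r • y)) 0 r := by
    intro r hr
    have hmaps : Set.MapsTo (fun z : ℝ × ℍ[ℝ] => x + z.1 • z.2)
        (Set.Ioo (-R) R ×ˢ tsupport radialBump) (Metric.ball x R) := fun z hz =>
      add_smul_mem_ball (abs_lt.2 hz.1) (by simpa using tsupport_radialBump_subset hz.2)
    have h1 := hasDerivAt_integral_of_isCompact (μ := volume) hasCompactSupport_radialBump.isCompact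
      isOpen_Ioo hr (f := fun r y => radialBump y • f (x + r • y))
      (f' := fun r y => radialBump y • fderiv ℝ f (x + r • y) y)
      (fun t y hy => by simp [image_eq_zero_of_notMem_tsupport hy])
      (fun t y hy => by simp [image_eq_zero_of_notMem_tsupport hy])
      (fun t ht => ?_) ?_ (fun t ht y hy => ?_)
    · have h0 : ∫ y, radialBump y • fderiv ℝ f (x + r • y) y = 0 := by
        -- The divergence identity carries a factor r and says nothing at r = 0; there the integrand
        -- is odd in y.
        rcases eq_or_ne r 0 with rfl | hr0
        · have h2 := integral_neg_eq_self
            (fun y => radialBump y • fderiv ℝ f (x + (0 : ℝ) • y) y) volume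
          simp only [radialBump_neg, map_neg, zero_smul, neg_zero, smul_neg, integral_neg] at h2 ⊢
          rw [neg_eq_iff_add_eq_zero, ← two_smul ℝ] at h2
          exact (smul_eq_zero_iff_right two_ne_zero).1 h2
        · exact (smul_eq_zero_iff_right hr0).1
            (smul_integral_radialBump_fderiv hf hd (abs_lt.2 hr))
      rwa [h0] at h1
    · refine contDiff_radialBump.continuous.continuousOn.smul
        (hf.continuousOn.comp (by fun_prop) fun y hy => ?_)
      exact hmaps (x := (t, y)) ⟨ht, hy⟩
    · have h2 := hf.continuousOn_fderiv_of_isOpen Metric.isOpen_ball (by simp)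
      exact (contDiff_radialBump.continuous.comp continuous_snd).continuousOn.smul
        ((h2.comp (by fun_prop) hmaps).clm_apply continuousOn_snd)
    · have h3 := (hf.contDiffAt (Metric.isOpen_ball.mem_nhds
        (hmaps (x := (t, y)) ⟨ht, hy⟩))).differentiableAt (by simp)
      have h4 : HasDerivAt (fun t : ℝ => x + t • y) y t := by
        simpa using ((hasDerivAt_id t).smul_const y).const_add x
      exact (h3.hasFDerivAt.comp_hasDerivAt t h4).const_smul (radialBump y)
  have hR : 0 < R := (abs_nonneg δ).trans_lt hδ
  have := (convex_Ioo (-R) R).norm_image_sub_le_of_norm_hasDerivWithin_le (C := 0)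
    (fun r hr => (hder r hr).hasDerivWithinAt) (fun r hr => by simp)
    (x := 0) (y := δ) ⟨by linarith, hR⟩ (abs_lt.1 hδ)
  rw [zero_mul, norm_le_zero_iff, sub_eq_zero] at this
  rw [this]
  simp only [zero_smul, add_zero]
  rw [integral_smul_const, radialMass]

end

section

/-! ### A smooth reproducing kernel for q-holomorphic functions -/

/-- The product bump function on `ℍ × ℍ`. -/
noncomputable def biBump (z : ℍ[ℝ] × ℍ[ℝ]) : ℝ := radialBump z.1 * radialBump z.2

theorem contDiff_biBump : ContDiff ℝ ∞ biBump :=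
  (contDiff_radialBump.comp contDiff_fst).mul (contDiff_radialBump.comp contDiff_snd)

theorem biBump_neg (z : ℍ[ℝ] × ℍ[ℝ]) : biBump (-z) = biBump z := by
  simp [biBump, radialBump_neg]

theorem radialBump_eq_zero {y : ℍ[ℝ]} (hy : 1 < ‖y‖) : radialBump y = 0 :=
  Real.smoothTransition.zero_of_nonpos (by nlinarith)

theorem biBump_eq_zero {z : ℍ[ℝ] × ℍ[ℝ]} (hz : 1 < ‖z‖) : biBump z = 0 := by
  rcases lt_sup_iff.1 hz with h | h <;> simp [biBump, radialBump_eq_zero h]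

/-- A smooth even kernel supported in the closed ball of radius `δ` which reproduces
q-holomorphic functions. -/
noncomputable def reproKernel (δ : ℝ) (z : ℍ[ℝ] × ℍ[ℝ]) : ℝ :=
  (radialMass ^ 2)⁻¹ * |(δ ^ Module.finrank ℝ (ℍ[ℝ] × ℍ[ℝ]))⁻¹| * biBump (δ⁻¹ • z)

theorem contDiff_reproKernel (δ : ℝ) : ContDiff ℝ ∞ (reproKernel δ) :=
  contDiff_const.mul (contDiff_biBump.comp (contDiff_const_smul _))

theorem reproKernel_neg (δ : ℝ) (z : ℍ[ℝ] × ℍ[ℝ]) : reproKernel δ (-z) = reproKernel δ z := by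
  simp [reproKernel, biBump_neg]

theorem reproKernel_eq_zero {δ : ℝ} (hδ : 0 < δ) {z : ℍ[ℝ] × ℍ[ℝ]} (hz : δ < ‖z‖) :
    reproKernel δ z = 0 := by
  rw [reproKernel, biBump_eq_zero, mul_zero]
  rwa [norm_smul, norm_inv, Real.norm_eq_abs, abs_of_pos hδ, inv_mul_eq_div, one_lt_div hδ]

theorem hasCompactSupport_reproKernel {δ : ℝ} (hδ : 0 < δ) : HasCompactSupport (reproKernel δ) :=
  HasCompactSupport.intro (isCompact_closedBall 0 δ) fun z hz =>
    reproKernel_eq_zero hδ (by simpa using hz)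

variable {F : ℍ[ℝ] × ℍ[ℝ] → ℍ[ℝ]} {U : Set (ℍ[ℝ] × ℍ[ℝ])} {q : ℍ[ℝ] × ℍ[ℝ]} {δ R : ℝ}

/-- Fubini and the one-variable mean value property, first in q₂ and then in q₁. The sup norm on the
product makes balls into products of balls. -/
theorem radialMass_sq_smul_eq_integral (hF : QHolomorphicOn F U) (hU : Metric.ball q R ⊆ U)
    (hδ : |δ| < R) : radialMass ^ 2 • F q = ∫ z, biBump z • F (q + δ • z) := by
  have hball : ∀ u v : ℍ[ℝ], u ∈ Metric.ball q.1 R → v ∈ Metric.ball q.2 R → (u, v) ∈ U := by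
    intro u v hu hv
    refine hU ?_
    rw [← Prod.mk.eta (p := q), ← ball_prod_same]
    exact ⟨hu, hv⟩
  have hR : 0 < R := (abs_nonneg δ).trans_lt hδ
  have hint : Integrable fun z => biBump z • F (q + δ • z) := by
    have h1 : ContinuousOn (fun z => biBump z • F (q + δ • z)) (Metric.closedBall 0 1) := by
      refine contDiff_biBump.continuous.continuousOn.smul
        (hF.1.continuousOn.comp (by fun_prop) fun z hz => ?_)
      rw [mem_closedBall_zero_iff] at hz
      exact hball _ _ (add_smul_mem_ball hδ ((le_max_left _ _).trans hz))
        (add_smul_mem_ball hδ ((le_max_right _ _).trans hz))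
    have h2 := (h1.integrableOn_compact (μ := volume)
      (isCompact_closedBall 0 1)).integrable_indicator measurableSet_closedBall
    refine h2.congr (.of_forall fun z => ?_)
    by_cases hz : z ∈ Metric.closedBall (0 : ℍ[ℝ] × ℍ[ℝ]) 1
    · simp [Set.indicator_of_mem hz]
    · simp [Set.indicator_of_notMem hz, biBump_eq_zero (z := z) (by simpa using hz)]
  rw [Measure.volume_eq_prod] at hint ⊢
  rw [integral_prod _ hint]
  have hinner : ∀ u, ∫ v, biBump (u, v) • F (q + δ • (u, v))
      = radialMass • radialBump u • F (q.1 + δ • u, q.2) := by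
    intro u
    by_cases hu : 1 < ‖u‖
    · simp [biBump, radialBump_eq_zero hu]
    · have hu' := add_smul_mem_ball (x := q.1) hδ (not_lt.1 hu)
      have h1 := radialMass_smul_eq_integral (f := fun y => F (q.1 + δ • u, y)) (x := q.2)
        (hF.1.comp (by fun_prop) fun y hy => hball _ _ hu' hy)
        (fun y hy => (hF.2 _ (hball _ _ hu' hy)).2) hδ
      rw [smul_comm, h1, ← integral_smul]
      simp only [biBump, mul_smul]
      rfl
  simp_rw [hinner]
  rw [integral_smul, ← radialMass_smul_eq_integral (f := fun x => F (x, q.2)) (x := q.1)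
        (hF.1.comp (by fun_prop) fun y hy => hball _ _ hy (Metric.mem_ball_self hR))
        (fun y hy => (hF.2 _ (hball _ _ hy (Metric.mem_ball_self hR))).1) hδ, ← mul_smul, sq]

/-- Rescaling turns the mean value property into a convolution. Truncating `F` to `S` changes
nothing where the kernel lives and makes the integrand globally meaningful. -/
theorem eq_integral_reproKernel (hF : QHolomorphicOn F U) (hU : Metric.ball q R ⊆ U)
    (h0 : 0 < δ) (hδ : δ < R) {S : Set (ℍ[ℝ] × ℍ[ℝ])} (hS : Metric.closedBall q δ ⊆ S) :
    F q = ∫ t, reproKernel δ (q - t) • S.indicator F t := by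
  have h1 := radialMass_sq_smul_eq_integral hF hU (by rwa [abs_of_pos h0])
  have h2 := Measure.integral_comp_smul volume
    (fun w => biBump (δ⁻¹ • w) • F (q + w)) δ
  simp only [inv_smul_smul₀ h0.ne'] at h2
  rw [h2, ← eq_inv_smul_iff₀ (pow_ne_zero 2 radialMass_pos.ne')] at h1
  rw [h1, ← mul_smul, ← integral_smul, ← integral_sub_right_eq_self _ q]
  refine integral_congr_ae (.of_forall fun t => ?_)
  beta_reduce
  rw [← mul_smul]
  -- The scalar is kept abstract here; it is matched with the kernel, using evenness, only at the
  -- end.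
  have h3 : ∀ s, s = reproKernel δ (q - t) → s • F (q + (t - q))
      = reproKernel δ (q - t) • S.indicator F t := by
    rintro _ rfl
    by_cases ht : δ < ‖q - t‖
    · simp [reproKernel_eq_zero h0 ht]
    · rw [add_sub_cancel, Set.indicator_of_mem (hS _)]
      rwa [Metric.mem_closedBall, dist_eq_norm, norm_sub_rev, ← not_lt]
  rw [h3]
  rw [← reproKernel_neg, neg_sub, reproKernel]

/-! ### Consequences of the reproducing kernel: limits and local bounds -/

/-- Convolution with a fixed function of compact support is continuous with respect to uniform
convergence. -/
theorem tendsto_convolution_of_tendstoUniformlyOn {E₁ E₂ E₃ X : Type*} [NormedAddCommGroup E₁]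
    [NormedSpace ℝ E₁] [NormedAddCommGroup E₂] [NormedSpace ℝ E₂] [NormedAddCommGroup E₃]
    [NormedSpace ℝ E₃] [NormedAddCommGroup X] [MeasurableSpace X] [BorelSpace X]
    [SecondCountableTopology X]
    {μ : Measure X} [IsFiniteMeasureOnCompacts μ] {f : ℕ → X → E₁} {g : X → E₁} {k : X → E₂}
    (L : E₁ →L[ℝ] E₂ →L[ℝ] E₃) {S : Set X} (hS : IsCompact S)
    (hfc : ∀ n, ContinuousOn (f n) S) (hg : ContinuousOn g S)
    (hf : TendstoUniformlyOn f g atTop S) (hk : Continuous k) (hkc : HasCompactSupport k) (x : X) :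
    Tendsto (fun n => convolution (S.indicator (f n)) k L μ x) atTop
      (𝓝 (convolution (S.indicator g) k L μ x)) := by
  obtain ⟨M, hM⟩ := hS.exists_bound_of_continuousOn hg
  obtain ⟨K, hK⟩ := hkc.exists_bound_of_continuous hk
  have hind : ∀ f : X → E₁, (fun t => L (S.indicator f t) (k (x - t)))
      = S.indicator fun t => L (f t) (k (x - t)) := by
    intro f; ext t
    by_cases ht : t ∈ S <;> simp [ht]
  refine tendsto_integral_filter_of_dominated_convergence
    (S.indicator fun _ => ‖L‖ * (M + 1) * K) (.of_forall fun n => ?_) ?_ ?_ (.of_forall fun t => ?_)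
  · rw [hind]
    have h1 : ContinuousOn (fun t => L (f n t) (k (x - t))) S :=
      (L.continuous.comp_continuousOn (hfc n)).clm_apply (by fun_prop)
    exact ((h1.integrableOn_compact (μ := μ) hS).integrable_indicator
      hS.measurableSet).aestronglyMeasurable
  · filter_upwards [Metric.tendstoUniformlyOn_iff.1 hf 1 one_pos] with n hn
    refine .of_forall fun t => ?_
    by_cases ht : t ∈ S
    · simp only [Set.indicator_of_mem ht]
      have h1 : ‖f n t‖ ≤ M + 1 := by
        have h2 := hn t ht
        rw [dist_comm, dist_eq_norm] at h2
        have h3 := norm_le_norm_add_norm_sub' (f n t) (g t)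
        linarith [hM t ht]
      calc ‖L (f n t) (k (x - t))‖ ≤ ‖L‖ * ‖f n t‖ * ‖k (x - t)‖ := L.le_opNorm₂ _ _
        _ ≤ ‖L‖ * (M + 1) * K := mul_le_mul (mul_le_mul_of_nonneg_left h1 L.opNorm_nonneg)
          (hK _) (norm_nonneg _) (mul_nonneg L.opNorm_nonneg ((norm_nonneg _).trans h1))
    · simp [ht]
  · exact (integrableOn_const hS.measure_lt_top.ne).integrable_indicator hS.measurableSet
  · by_cases ht : t ∈ S
    · simp only [Set.indicator_of_mem ht]
      exact ((L.continuous.clm_apply continuous_const).tendsto _).comp (hf.tendsto_at ht)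
    · simp [ht]

/-- Locally uniform limits of q-holomorphic functions are q-holomorphic. -/
theorem TendstoLocallyUniformlyOn.qHolomorphicOn {f : ℕ → ℍ[ℝ] × ℍ[ℝ] → ℍ[ℝ]}
    (hU : IsOpen U) (hf : ∀ n, QHolomorphicOn (f n) U)
    (h : TendstoLocallyUniformlyOn f F atTop U) : QHolomorphicOn F U := by
  have hFc : ContinuousOn F U := h.continuousOn (.of_forall fun n => (hf n).1.continuousOn)
  have main : ∀ q ∈ U, ContDiffAt ℝ ∞ F q ∧
      Tendsto (fun n => fderiv ℝ (f n) q) atTop (𝓝 (fderiv ℝ F q)) := by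
    intro q hq
    obtain ⟨R, hR, hRU⟩ := Metric.nhds_basis_closedBall.mem_iff.1 (hU.mem_nhds hq)
    set S := Metric.closedBall q R
    have hS : IsCompact S := isCompact_closedBall q R
    have hu : TendstoUniformlyOn f F atTop S :=
      (tendstoLocallyUniformlyOn_iff_tendstoUniformlyOn_of_compact hS).1 (h.mono hRU)
    have hSm : MeasurableSet S := hS.measurableSet
    let L : ℍ[ℝ] →L[ℝ] ℝ →L[ℝ] ℍ[ℝ] := (ContinuousLinearMap.lsmul ℝ ℝ).flip
    set k := reproKernel (R / 3)
    have hk : ContDiff ℝ ∞ k := contDiff_reproKernel _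
    have hkc : HasCompactSupport k := hasCompactSupport_reproKernel (by positivity)
    -- For x within R/3 of q, the ball of radius 2R/3 about x lies in `S`, which leaves room for a
    -- kernel of radius R/3.
    have hrep : ∀ n, ∀ x ∈ Metric.ball q (R / 3),
        f n x = convolution (S.indicator (f n)) k L volume x := by
      intro n x hx
      rw [Metric.mem_ball] at hx
      refine eq_integral_reproKernel (hf n) (R := 2 * R / 3) (fun y hy => hRU ?_) (by positivity)
        (by linarith) (fun y hy => ?_)
      · rw [Metric.mem_ball] at hy
        exact Metric.mem_closedBall.2 (by linarith [dist_triangle y x q])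
      · rw [Metric.mem_closedBall] at hy
        exact Metric.mem_closedBall.2 (by linarith [dist_triangle y x q])
    -- The reproducing formula passes to the limit; smoothness of `F` and convergence of derivatives
    -- then come from differentiating the kernel.
    have hrepF : ∀ x ∈ Metric.ball q (R / 3), F x = convolution (S.indicator F) k L volume x := by
      intro x hx
      have hxS : x ∈ S := Metric.ball_subset_closedBall
        (Metric.ball_subset_ball (by linarith) hx)
      refine tendsto_nhds_unique (hu.tendsto_at hxS) ?_
      simp_rw [hrep _ x hx]
      exact tendsto_convolution_of_tendstoUniformlyOn L hS
        (fun n => (hf n).1.continuousOn.mono hRU) (hFc.mono hRU) hu hk.continuous hkc x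
    have hnb : Metric.ball q (R / 3) ∈ 𝓝 q := Metric.ball_mem_nhds q (by positivity)
    have hli : ∀ g : ℍ[ℝ] × ℍ[ℝ] → ℍ[ℝ], ContinuousOn g U →
        LocallyIntegrable (S.indicator g) volume := fun g hg =>
      (((hg.mono hRU).integrableOn_compact hS).integrable_indicator hSm).locallyIntegrable
    have hfd : ∀ g : ℍ[ℝ] × ℍ[ℝ] → ℍ[ℝ], ContinuousOn g U →
        (∀ x ∈ Metric.ball q (R / 3), g x = convolution (S.indicator g) k L volume x) →
        fderiv ℝ g q = convolution (𝕜 := ℝ) (S.indicator g) (fderiv ℝ k)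
          (ContinuousLinearMap.precompR (ℍ[ℝ] × ℍ[ℝ]) L) volume q := by
      intro g hg hrep
      have h1 : g =ᶠ[𝓝 q] convolution (S.indicator g) k L volume := by
        filter_upwards [hnb] with x hx using hrep x hx
      rw [h1.fderiv_eq]
      exact (hkc.hasFDerivAt_convolution_right L (hli g hg) (hk.of_le (by simp)) q).fderiv
    refine ⟨?_, ?_⟩
    · have h1 : F =ᶠ[𝓝 q] convolution (S.indicator F) k L volume := by
        filter_upwards [hnb] with x hx using hrepF x hx
      exact (hkc.contDiff_convolution_right L (hli F hFc) hk).contDiffAt.congr_of_eventuallyEq h1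
    · rw [hfd F hFc hrepF]
      simp_rw [fun n => hfd (f n) (hf n).1.continuousOn (hrep n)]
      exact tendsto_convolution_of_tendstoUniformlyOn _ hS
        (fun n => (hf n).1.continuousOn.mono hRU) (hFc.mono hRU) hu
        (hk.continuous_fderiv (by simp)) (hkc.fderiv (𝕜 := ℝ)) q
  refine ⟨fun q hq => (main q hq).1.contDiffWithinAt, fun q hq => ?_⟩
  have hd : DifferentiableAt ℝ F q := (main q hq).1.differentiableAt (by simp)
  have ht : ∀ v, Tendsto (fun n => fderiv ℝ (f n) q v) atTop (𝓝 (fderiv ℝ F q v)) := fun v =>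
    ((ContinuousLinearMap.apply ℝ ℍ[ℝ] v).continuous.tendsto _).comp (main q hq).2
  refine ⟨?_, ?_⟩
  · rw [dbarLeft_fst_eq hd]
    refine tendsto_nhds_unique ((((((ht (1, 0)).add ((ht (i₁, 0)).const_mul i₁)).add
      ((ht (i₂, 0)).const_mul i₂)).add ((ht (i₃, 0)).const_mul i₃)).const_smul (1 / 2 : ℝ))) ?_
    simp_rw [← fun n => dbarLeft_fst_eq ((hf n).differentiableAt hU hq), fun n => ((hf n).2 q hq).1]
    exact tendsto_const_nhds
  · rw [dbarLeft_snd_eq hd]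
    refine tendsto_nhds_unique ((((((ht (0, 1)).add ((ht (0, i₁)).const_mul i₁)).add
      ((ht (0, i₂)).const_mul i₂)).add ((ht (0, i₃)).const_mul i₃)).const_smul (1 / 2 : ℝ))) ?_
    simp_rw [← fun n => dbarLeft_snd_eq ((hf n).differentiableAt hU hq), fun n => ((hf n).2 q hq).2]
    exact tendsto_const_nhds

/-- Local uniform bound of a q-holomorphic function by its local `L²` norm. -/
theorem exists_enorm_le_eLpNorm {R : ℝ} (hR : 0 < R) (q : ℍ[ℝ] × ℍ[ℝ]) :
    ∃ C : ℝ≥0∞, C ≠ ⊤ ∧ ∀ F : ℍ[ℝ] × ℍ[ℝ] → ℍ[ℝ], QHolomorphicOn F (Metric.closedBall q R) →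
      ∀ x ∈ Metric.ball q (R / 3),
        ‖F x‖ₑ ≤ C * eLpNorm F 2 (volume.restrict (Metric.closedBall q R)) := by
  set S := Metric.closedBall q R with hSdef
  obtain ⟨K, hK⟩ := (hasCompactSupport_reproKernel (δ := R / 3)
    (by positivity)).exists_bound_of_continuous (contDiff_reproKernel _).continuous
  -- Sup of the kernel times the Cauchy–Schwarz factor for passing from L¹ to L² on `S`.
  refine ⟨ENNReal.ofReal K * volume S ^ ((1 : ℝ) / 2), ENNReal.mul_ne_top ENNReal.ofReal_ne_top
    (ENNReal.rpow_ne_top_of_nonneg (by norm_num)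
      (isCompact_closedBall q R).measure_lt_top.ne), fun F hF x hx => ?_⟩
  rw [Metric.mem_ball] at hx
  rw [eq_integral_reproKernel hF (R := 2 * R / 3) (δ := R / 3) (S := S) (fun y hy => ?_)
    (by positivity) (by linarith) (fun y hy => ?_)]
  rotate_left
  · rw [Metric.mem_ball] at hy
    exact Metric.mem_closedBall.2 (by linarith [dist_triangle y x q])
  · rw [Metric.mem_closedBall] at hy
    exact Metric.mem_closedBall.2 (by linarith [dist_triangle y x q])
  have hSm : MeasurableSet S := Metric.isClosed_closedBall.measurableSet
  calc ‖∫ t, reproKernel (R / 3) (x - t) • S.indicator F t‖ₑ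
      ≤ ∫⁻ t, ‖reproKernel (R / 3) (x - t) • S.indicator F t‖ₑ := enorm_integral_le_lintegral_enorm _
    _ ≤ ∫⁻ t, S.indicator (fun t => ENNReal.ofReal K * ‖F t‖ₑ) t := by
        refine lintegral_mono fun t => ?_
        by_cases ht : t ∈ S
        · simp only [Set.indicator_of_mem ht, enorm_smul]
          gcongr
          rw [← ofReal_norm]
          exact ENNReal.ofReal_le_ofReal (hK _)
        · simp [ht]
    _ = ENNReal.ofReal K * eLpNorm F 1 (volume.restrict S) := by
        rw [lintegral_indicator hSm, lintegral_const_mul' _ _ ENNReal.ofReal_ne_top,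
          eLpNorm_one_eq_lintegral_enorm]
    _ ≤ ENNReal.ofReal K * (eLpNorm F 2 (volume.restrict S) * volume S ^ ((1 : ℝ) / 2)) := by
        gcongr
        have := eLpNorm_le_eLpNorm_mul_rpow_measure_univ (p := 1) (q := 2) one_le_two
          (hF.1.continuousOn.aestronglyMeasurable (μ := volume) hSm)
        norm_num at this
        simpa using this
    _ = _ := by ring

end

/-! ### Integration over the Siegel half space -/

/-- The linear identification of `ℝ × (ℍ × ℝ³)` with `ℍ × ℍ`. -/
noncomputable def heightEquiv : (ℝ × (ℍ[ℝ] × EuclideanSpace ℝ (Fin 3))) ≃L[ℝ] (ℍ[ℝ] × ℍ[ℝ]) :=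
  LinearEquiv.toContinuousLinearEquiv
  { toFun := fun z => (z.2.1, z.1 • (1 : ℍ[ℝ]) + imEmbed z.2.2)
    map_add' := fun x y => by
      ext1 <;> simp [add_smul]
      abel
    map_smul' := fun c x => by ext1 <;> simp [mul_smul]
    invFun := fun q => (q.2.re, (q.1, !₂[q.2.imI, q.2.imJ, q.2.imK]))
    left_inv := fun z => by
      refine Prod.ext ?_ (Prod.ext rfl ?_)
      · simp [imEmbed_apply]
      · ext m; fin_cases m <;> simp [imEmbed_apply]
    right_inv := fun q => by
      refine Prod.ext rfl ?_
      ext <;> simp [imEmbed_apply] }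

/-- The curved coordinates are a linear isomorphism composed with a shear in the first variable, so
only translation invariance is needed to change variables. -/
theorem heightEquiv_apply (s : ℝ) (p : ℍ[ℝ] × EuclideanSpace ℝ (Fin 3)) :
    heightEquiv (s + ‖p.1‖ ^ 2, p) = siegelCoord s p := by
  simp [heightEquiv, siegelCoord, add_comm]

instance : (volume : Measure (ℝ × (ℍ[ℝ] × EuclideanSpace ℝ (Fin 3)))).IsAddHaarMeasure :=
  Measure.prod.instIsAddHaarMeasure _ _

/-- Integration in the coordinates consisting of the height above the boundary and the projection
to the boundary. -/
theorem exists_lintegral_eq_siegelCoord : ∃ c : ℝ≥0, ∀ g : ℍ[ℝ] × ℍ[ℝ] → ℝ≥0∞, Measurable g →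
    ∫⁻ q, g q = c * ∫⁻ s : ℝ, ∫⁻ p, g (siegelCoord s p) := by
  have hm : Measurable heightEquiv := heightEquiv.continuous.measurable
  have : (Measure.map heightEquiv volume).IsAddHaarMeasure :=
    heightEquiv.isAddHaarMeasure_map volume
  refine ⟨(volume : Measure (ℍ[ℝ] × ℍ[ℝ])).addHaarScalarFactor (Measure.map heightEquiv volume),
    fun g hg => ?_⟩
  conv_lhs => rw [Measure.isAddLeftInvariant_eq_smul (volume : Measure (ℍ[ℝ] × ℍ[ℝ]))
    (Measure.map heightEquiv volume)]
  rw [lintegral_smul_measure, lintegral_map hg hm, ENNReal.smul_def, smul_eq_mul]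
  congr 1
  have h1 : Measurable fun z => g (heightEquiv z) := hg.comp hm
  have h2 : Measurable fun z : ℝ × (ℍ[ℝ] × EuclideanSpace ℝ (Fin 3)) => g (siegelCoord z.1 z.2) :=
    hg.comp contDiff_siegelCoord.continuous.measurable
  -- With the boundary integral outermost, p is fixed and the shear is a translation of the real
  -- line.
  rw [Measure.volume_eq_prod, lintegral_prod_symm _ h1.aemeasurable,
    lintegral_lintegral_swap (f := fun s p => g (siegelCoord s p)) h2.aemeasurable]
  refine lintegral_congr fun p => ?_
  rw [← lintegral_add_right_eq_self _ (‖p.1‖ ^ 2)]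
  simp only [heightEquiv_apply]

/-- The square integral over a subset of bounded height is controlled by the Hardy norm. -/
theorem exists_eLpNorm_le_hardySup {S : Set (ℍ[ℝ] × ℍ[ℝ])} (hS : IsCompact S) (hSs : S ⊆ siegel) :
    ∃ C : ℝ≥0∞, C ≠ ⊤ ∧ ∀ F : ℍ[ℝ] × ℍ[ℝ] → ℍ[ℝ], ContinuousOn F siegel →
      eLpNorm F 2 (volume.restrict S) ^ 2 ≤ C * hardySup F := by
  obtain ⟨c, hc⟩ := exists_lintegral_eq_siegelCoord
  obtain ⟨T, hT⟩ := hS.exists_bound_of_continuousOn (f := fun q => q.2.re)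
    (Quaternion.continuous_re.comp continuous_snd).continuousOn
  refine ⟨c * ENNReal.ofReal T, ENNReal.mul_ne_top ENNReal.coe_ne_top ENNReal.ofReal_ne_top,
    fun F hF => ?_⟩
  have hFm : Measurable (S.indicator F) := by
    classical
    have h := (hF.mono hSs).measurable_piecewise (g := fun _ => 0) continuousOn_const
      hS.measurableSet
    exact Set.piecewise_eq_indicator (s := S) (f := F) ▸ h
  have hle : ∀ s : ℝ, ∫⁻ p, ‖S.indicator F (siegelCoord s p)‖ₑ ^ 2
      ≤ (Set.Ioc 0 T).indicator (fun _ => hardySup F) s := by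
    intro s
    by_cases hs : s ∈ Set.Ioc 0 T
    · rw [Set.indicator_of_mem hs]
      calc ∫⁻ p, ‖S.indicator F (siegelCoord s p)‖ₑ ^ 2
          ≤ ∫⁻ p, ‖boundaryTranslate F s (boundaryParam p)‖ₑ ^ 2 := by
            refine lintegral_mono fun p => ?_
            rw [boundaryTranslate_boundaryParam]
            gcongr
            exact enorm_indicator_le_enorm_self _ _
        _ = ∫⁻ q, ‖boundaryTranslate F s q‖ₑ ^ 2 ∂beta :=
            (lintegral_beta ((hF.continuous_boundaryTranslate hs.1).enorm.measurable.pow_const 2)).symm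
        _ ≤ hardySup F := le_iSup₂
            (f := fun s (_ : 0 < s) => ∫⁻ q, ‖boundaryTranslate F s q‖ₑ ^ 2 ∂beta) s hs.1
    · rw [Set.indicator_of_notMem hs]
      -- Points of `S` have positive height, and their height is at most Re q₂ ≤ T.
      have h0 : ∀ p, siegelCoord s p ∉ S := by
        intro p hp
        have h1 : ‖p.1‖ ^ 2 < (siegelCoord s p).2.re := hSs hp
        have h2 := (le_abs_self _).trans (hT _ hp)
        rw [siegelCoord_snd_re] at h1 h2
        exact hs ⟨by linarith, by linarith [sq_nonneg ‖p.1‖]⟩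
      simp [h0]
  calc eLpNorm F 2 (volume.restrict S) ^ 2
      = ∫⁻ q, ‖S.indicator F q‖ₑ ^ 2 := by
        rw [← eLpNorm_indicator_eq_eLpNorm_restrict hS.measurableSet, eLpNorm_two_sq]
    _ = c * ∫⁻ s : ℝ, ∫⁻ p, ‖S.indicator F (siegelCoord s p)‖ₑ ^ 2 := hc _ (hFm.enorm.pow_const 2)
    _ ≤ c * ∫⁻ s : ℝ, (Set.Ioc 0 T).indicator (fun _ => hardySup F) s := by
        gcongr with s
        exact hle s
    _ = c * ENNReal.ofReal T * hardySup F := by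
        rw [lintegral_indicator measurableSet_Ioc, setLIntegral_const, Real.volume_Ioc, sub_zero]
        ring

section

/-! ### Linear structure of the Hardy space -/

variable {F F' : ℍ[ℝ] × ℍ[ℝ] → ℍ[ℝ]} {U : Set (ℍ[ℝ] × ℍ[ℝ])} {G G' : Lp ℍ[ℝ] 2 beta}

theorem QuaternionSiegel.QHolomorphicOn.add (hU : IsOpen U) (hF : QHolomorphicOn F U)
    (hF' : QHolomorphicOn F' U) : QHolomorphicOn (F + F') U := by
  refine ⟨hF.1.add hF'.1, fun q hq => ?_⟩
  have d := hF.differentiableAt hU hq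
  have d' := hF'.differentiableAt hU hq
  have h := hF.2 q hq
  have h' := hF'.2 q hq
  rw [dbarLeft_fst_eq d, dbarLeft_snd_eq d] at h
  rw [dbarLeft_fst_eq d', dbarLeft_snd_eq d'] at h'
  rw [dbarLeft_fst_eq (d.add d'), dbarLeft_snd_eq (d.add d'), fderiv_add d d']
  refine ⟨?_, ?_⟩
  · have := congrArg₂ (· + ·) h.1 h'.1
    simp only [← smul_add, add_zero] at this
    refine Eq.trans ?_ this
    congr 1
    simp only [_root_.add_apply, mul_add]
    abel
  · have := congrArg₂ (· + ·) h.2 h'.2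
    simp only [← smul_add, add_zero] at this
    refine Eq.trans ?_ this
    congr 1
    simp only [_root_.add_apply, mul_add]
    abel

/-- Right multiplication by a constant commutes with an operator whose coefficients act on the left.
-/
theorem QuaternionSiegel.QHolomorphicOn.op_smul (hU : IsOpen U) (hF : QHolomorphicOn F U)
    (c : ℍ[ℝ]ᵐᵒᵖ) : QHolomorphicOn (c • F) U := by
  have e : c • F = fun q => F q * c.unop := rfl
  rw [e]
  refine ⟨hF.1.mul contDiffOn_const, fun q hq => ?_⟩
  have d := hF.differentiableAt hU hq
  have h := hF.2 q hq
  have hd : ∀ v, fderiv ℝ (fun q => F q * c.unop) q v = fderiv ℝ F q v * c.unop := fun v => by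
    rw [(d.hasFDerivAt.mul_const' c.unop).fderiv]
    rfl
  rw [dbarLeft_fst_eq d, dbarLeft_snd_eq d] at h
  rw [dbarLeft_fst_eq (d.mul_const _), dbarLeft_snd_eq (d.mul_const _)]
  simp only [hd, ← mul_assoc, ← add_mul, ← smul_mul_assoc]
  rw [h.1, h.2, zero_mul]
  exact ⟨rfl, rfl⟩

/-- Membership in the Hardy space together with the boundary value. -/
def HasBoundaryValue (F : ℍ[ℝ] × ℍ[ℝ] → ℍ[ℝ]) (G : Lp ℍ[ℝ] 2 beta) : Prop :=
  MemHardy F ∧ IsBoundaryValue F G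

theorem boundaryTranslate_add (s : ℝ) :
    boundaryTranslate (F + F') s = boundaryTranslate F s + boundaryTranslate F' s := rfl

theorem boundaryTranslate_op_smul (c : ℍ[ℝ]ᵐᵒᵖ) (s : ℝ) :
    boundaryTranslate (c • F) s = c • boundaryTranslate F s := rfl

theorem HasBoundaryValue.add (h : HasBoundaryValue F G) (h' : HasBoundaryValue F' G') :
    HasBoundaryValue (F + F') (G + G') := by
  have hm : MemHardy (F + F') := by
    refine ⟨h.1.1.add isOpen_siegel h'.1.1, (hardySup_le (C := ‖G‖ₑ + ‖G'‖ₑ) fun s hs => ?_).trans_lt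
      (ENNReal.pow_lt_top (ENNReal.add_lt_top.2 ⟨enorm_lt_top, enorm_lt_top⟩))⟩
    rw [boundaryTranslate_add]
    exact (eLpNorm_add_le (h.1.memLp hs).1 (h'.1.memLp hs).1 one_le_two).trans
      (add_le_add (h.2.eLpNorm_le h.1 hs) (h'.2.eLpNorm_le h'.1 hs))
  refine ⟨hm, (isBoundaryValue_iff_tendsto hm _).2 ?_⟩
  refine Tendsto.congr' ?_ (((isBoundaryValue_iff_tendsto h.1 _).1 h.2).add
    ((isBoundaryValue_iff_tendsto h'.1 _).1 h'.2))
  filter_upwards [self_mem_nhdsWithin] with s hs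
  refine Lp.ext ?_
  filter_upwards [Lp.coeFn_add (h.1.curve s) (h'.1.curve s), hm.coeFn_curve hs,
    h.1.coeFn_curve hs, h'.1.coeFn_curve hs] with q h1 h2 h3 h4
  rw [h1, h2, boundaryTranslate_add, Pi.add_apply, Pi.add_apply, h3, h4]

theorem HasBoundaryValue.op_smul (h : HasBoundaryValue F G) (c : ℍ[ℝ]ᵐᵒᵖ) :
    HasBoundaryValue (c • F) (c • G) := by
  have hm : MemHardy (c • F) := by
    refine ⟨h.1.1.op_smul isOpen_siegel c, (hardySup_le (C := ‖c‖ₑ * ‖G‖ₑ) fun s hs => ?_).trans_lt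
      (ENNReal.pow_lt_top (ENNReal.mul_lt_top enorm_lt_top enorm_lt_top))⟩
    rw [boundaryTranslate_op_smul]
    exact eLpNorm_const_smul_le.trans (mul_le_mul_right (h.2.eLpNorm_le h.1 hs) _)
  refine ⟨hm, (isBoundaryValue_iff_tendsto hm _).2 ?_⟩
  refine Tendsto.congr' ?_ (((isBoundaryValue_iff_tendsto h.1 _).1 h.2).const_smul c)
  filter_upwards [self_mem_nhdsWithin] with s hs
  refine Lp.ext ?_
  filter_upwards [Lp.coeFn_smul c (h.1.curve s), hm.coeFn_curve hs,
    h.1.coeFn_curve hs] with q h1 h2 h3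
  rw [h1, h2, boundaryTranslate_op_smul, Pi.smul_apply, Pi.smul_apply, h3]

theorem HasBoundaryValue.sub (h : HasBoundaryValue F G) (h' : HasBoundaryValue F' G') :
    HasBoundaryValue (F - F') (G - G') := by
  have := h.add (h'.op_smul (-1))
  simpa [sub_eq_add_neg] using this

theorem hasBoundaryValue_zero : HasBoundaryValue 0 0 := by
  have hz : ∀ s, boundaryTranslate 0 s = 0 := fun s => rfl
  refine ⟨⟨⟨contDiffOn_const, fun q _ => ?_⟩, ?_⟩, ?_⟩
  · simp [dbarLeft]
  · refine (hardySup_le (C := 0) fun s _ => ?_).trans_lt (by simp)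
    simp [hz]
  · have h0 : ∀ s, eLpNorm (fun q => boundaryTranslate 0 s q - (0 : Lp ℍ[ℝ] 2 beta) q) 2 beta = 0 := by
      intro s
      rw [← eLpNorm_zero (ε := ℍ[ℝ]) (p := 2) (μ := beta)]
      refine eLpNorm_congr_ae ?_
      filter_upwards [Lp.coeFn_zero ℍ[ℝ] 2 beta] with q hq
      rw [hq, hz, Pi.zero_apply, sub_zero]
    simp only [IsBoundaryValue, h0]
    exact tendsto_const_nhds

/-! ### Closedness of the space of boundary values -/

/-- Point evaluations on the Hardy space are locally uniformly bounded. -/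
theorem exists_norm_le_norm_boundaryValue {q : ℍ[ℝ] × ℍ[ℝ]} (hq : q ∈ siegel) :
    ∃ r > 0, Metric.ball q r ⊆ siegel ∧ ∃ C : ℝ, ∀ F G, HasBoundaryValue F G →
      ∀ x ∈ Metric.ball q r, ‖F x‖ ≤ C * ‖G‖ := by
  obtain ⟨R, hR, hRU⟩ := Metric.nhds_basis_closedBall.mem_iff.1 (isOpen_siegel.mem_nhds hq)
  obtain ⟨C, hC, h1⟩ := exists_enorm_le_eLpNorm hR q
  obtain ⟨C', hC', h2⟩ := exists_eLpNorm_le_hardySup (isCompact_closedBall q R) hRU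
  refine ⟨R / 3, by positivity, (Metric.ball_subset_closedBall.trans
    (Metric.closedBall_subset_closedBall (by linarith))).trans hRU,
    Real.sqrt (C ^ 2 * C').toReal, fun F G h x hx => ?_⟩
  have h3 : ‖F x‖ₑ ^ 2 ≤ C ^ 2 * C' * ‖G‖ₑ ^ 2 := by
    calc ‖F x‖ₑ ^ 2 ≤ (C * eLpNorm F 2 (volume.restrict (Metric.closedBall q R))) ^ 2 := by
          gcongr
          exact h1 F ⟨h.1.1.1.mono hRU, fun y hy => h.1.1.2 y (hRU hy)⟩ x hx
      _ ≤ C ^ 2 * (C' * hardySup F) := by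
          rw [mul_pow]
          gcongr
          exact h2 F h.1.1.1.continuousOn
      _ = C ^ 2 * C' * ‖G‖ₑ ^ 2 := by rw [h.2.hardySup_eq h.1, mul_assoc]
  have h4 := ENNReal.toReal_mono (ENNReal.mul_ne_top (ENNReal.mul_ne_top
    (ENNReal.pow_ne_top hC) hC') (ENNReal.pow_ne_top enorm_ne_top)) h3
  rw [ENNReal.toReal_mul, ENNReal.toReal_pow, ENNReal.toReal_pow, toReal_enorm, toReal_enorm] at h4
  refine le_of_sq_le_sq ?_ (by positivity)
  rwa [mul_pow, Real.sq_sqrt ENNReal.toReal_nonneg]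

/-- Limits of boundary values are boundary values. -/
theorem exists_hasBoundaryValue_of_tendsto {f : ℕ → ℍ[ℝ] × ℍ[ℝ] → ℍ[ℝ]} {g : ℕ → Lp ℍ[ℝ] 2 beta}
    (h : ∀ n, HasBoundaryValue (f n) (g n)) (hg : Tendsto g atTop (𝓝 G)) :
    ∃ F, HasBoundaryValue F G := by
  have hcau : ∀ {C ε : ℝ}, 0 < ε → ∃ N, ∀ n ≥ N, ∀ m ≥ N, C * ‖g n - g m‖ < ε := by
    intro C ε hε
    obtain ⟨N, hN⟩ := Metric.cauchySeq_iff.1 hg.cauchySeq (ε / (|C| + 1)) (by positivity)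
    refine ⟨N, fun n hn m hm => ?_⟩
    have h1 := hN n hn m hm
    rw [dist_eq_norm, lt_div_iff₀ (by positivity)] at h1
    nlinarith [le_abs_self C, norm_nonneg (g n - g m)]
  have hlim : ∀ q ∈ siegel, ∃ l, Tendsto (fun n => f n q) atTop (𝓝 l) := by
    intro q hq
    obtain ⟨r, hr, -, C, hC⟩ := exists_norm_le_norm_boundaryValue hq
    refine cauchySeq_tendsto_of_complete (Metric.cauchySeq_iff.2 fun ε hε => ?_)
    obtain ⟨N, hN⟩ := hcau (C := C) hε
    refine ⟨N, fun m hm n hn => ?_⟩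
    rw [dist_eq_norm]
    exact (hC _ _ ((h m).sub (h n)) q (Metric.mem_ball_self hr)).trans_lt (hN m hm n hn)
  -- Values off the half space are arbitrary and never enter.
  choose! F hF using hlim
  have hloc : TendstoLocallyUniformlyOn f F atTop siegel := by
    rw [Metric.tendstoLocallyUniformlyOn_iff]
    intro ε hε q hq
    obtain ⟨r, hr, hrs, C, hC⟩ := exists_norm_le_norm_boundaryValue hq
    obtain ⟨N, hN⟩ := hcau (C := C) (half_pos hε)
    refine ⟨Metric.ball q r, mem_nhdsWithin_of_mem_nhds (Metric.ball_mem_nhds q hr), ?_⟩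
    filter_upwards [eventually_ge_atTop N] with n hn y hy
    refine lt_of_le_of_lt ?_ (half_lt_self hε)
    refine le_of_tendsto ((hF y (hrs hy)).dist tendsto_const_nhds) ?_
    filter_upwards [eventually_ge_atTop N] with m hm
    rw [dist_eq_norm]
    exact (hC _ _ ((h m).sub (h n)) y hy).trans (hN m hm n hn).le
  have hq : QHolomorphicOn F siegel := hloc.qHolomorphicOn isOpen_siegel fun n => (h n).1.1
  -- Fatou's lemma in m, applied to the translates of f m - f n, each dominated by ‖g m - g n‖.
  have hle : ∀ n s, 0 < s → eLpNorm (boundaryTranslate (F - f n) s) 2 beta ≤ ‖G - g n‖ₑ := by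
    intro n s hs
    refine (Lp.eLpNorm_lim_le_liminf_eLpNorm
      (f := fun m => boundaryTranslate (f m - f n) s)
      (fun m => (((h m).sub (h n)).1.memLp hs).1) _ (.of_forall fun x =>
        (hF _ (mem_siegel_of_mem_boundary hs x)).sub_const _)).trans ?_
    have ht : Tendsto (fun m => ‖g m - g n‖ₑ) atTop (𝓝 ‖G - g n‖ₑ) := (hg.sub_const _).enorm
    rw [← ht.liminf_eq]
    exact liminf_le_liminf (.of_forall fun m =>
      ((h m).sub (h n)).2.eLpNorm_le ((h m).sub (h n)).1 hs)
  have hm : MemHardy F := by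
    refine ⟨hq, (hardySup_le (C := ‖G - g 0‖ₑ + ‖g 0‖ₑ) fun s hs => ?_).trans_lt
      (ENNReal.pow_lt_top (ENNReal.add_lt_top.2 ⟨enorm_lt_top, enorm_lt_top⟩))⟩
    have e : boundaryTranslate F s
        = boundaryTranslate (F - f 0) s + boundaryTranslate (f 0) s := by
      rw [← boundaryTranslate_add, sub_add_cancel]
    rw [e]
    refine (eLpNorm_add_le ?_ ((h 0).1.memLp hs).1 one_le_two).trans
      (add_le_add (hle 0 s hs) ((h 0).2.eLpNorm_le (h 0).1 hs))
    exact (hq.1.continuousOn.sub (h 0).1.1.1.continuousOn).aestronglyMeasurable_boundaryTranslate hs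
  obtain ⟨G', hG'⟩ := hm.exists_isBoundaryValue
  have hH : HasBoundaryValue F G' := ⟨hm, hG'⟩
  -- By the isometry, ‖G' - g n‖ is the Hardy norm of F - f n, which `hle` bounds. So g n also
  -- converges to G', and G = G'.
  have hn : ∀ n, ‖g n - G'‖ ≤ ‖g n - G‖ := by
    intro n
    have h1 := (hH.sub (h n)).2.hardySup_eq (hH.sub (h n)).1
    have h2 := hardySup_le (hle n)
    rw [h1] at h2
    rw [norm_sub_rev _ G', norm_sub_rev _ G]
    exact enorm_le_iff_norm_le.1 ((ENNReal.pow_le_pow_left_iff two_ne_zero).1 h2)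
  have hGG : G = G' := by
    refine tendsto_nhds_unique hg (tendsto_iff_norm_sub_tendsto_zero.2 ?_)
    exact squeeze_zero (fun _ => norm_nonneg _) hn (tendsto_iff_norm_sub_tendsto_zero.1 hg)
  exact ⟨F, hGG ▸ hH⟩

/-- The boundary values of functions in the Hardy space form a right quaternionic subspace. -/
def boundaryValueSubmodule : Submodule ℍ[ℝ]ᵐᵒᵖ (Lp ℍ[ℝ] 2 beta) where
  carrier := {G | ∃ F, HasBoundaryValue F G}
  add_mem' := fun ⟨F, hF⟩ ⟨F', hF'⟩ => ⟨F + F', hF.add hF'⟩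
  zero_mem' := ⟨0, hasBoundaryValue_zero⟩
  smul_mem' := fun c _ ⟨F, hF⟩ => ⟨c • F, hF.op_smul c⟩

theorem isClosed_boundaryValueSubmodule :
    IsClosed (boundaryValueSubmodule : Set (Lp ℍ[ℝ] 2 beta)) := by
  refine IsSeqClosed.isClosed fun g G hg hG => ?_
  choose f hf using hg
  exact exists_hasBoundaryValue_of_tendsto hf hG

end

/-! ### The theorem -/

theorem theorem4p2 :
    -- existence of the boundary function as an L² limit
    (∀ F : ℍ[ℝ] × ℍ[ℝ] → ℍ[ℝ], MemHardy F →
      (∀ ε : ℝ, 0 < ε → MemLp (boundaryTranslate F ε) 2 beta) ∧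
      ∃! G : Lp ℍ[ℝ] 2 beta, IsBoundaryValue F G) ∧
    -- the boundary functions form a closed (right quaternionic) linear subspace
    (∃ S : Submodule ℍ[ℝ]ᵐᵒᵖ (Lp ℍ[ℝ] 2 beta),
      (S : Set (Lp ℍ[ℝ] 2 beta)) =
        {G | ∃ F : ℍ[ℝ] × ℍ[ℝ] → ℍ[ℝ], MemHardy F ∧ IsBoundaryValue F G} ∧
      IsClosed (S : Set (Lp ℍ[ℝ] 2 beta))) ∧
    -- the boundary map preserves norms
    (∀ (F : ℍ[ℝ] × ℍ[ℝ] → ℍ[ℝ]) (G : Lp ℍ[ℝ] 2 beta),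
      MemHardy F → IsBoundaryValue F G → ‖G‖ = hardyNorm F) := by
  refine ⟨fun F hF => ⟨fun s hs => hF.memLp hs, ?_⟩,
    ⟨boundaryValueSubmodule, rfl, isClosed_boundaryValueSubmodule⟩,
    fun F G hF hG => hG.norm_eq hF⟩
  obtain ⟨G, hG⟩ := hF.exists_isBoundaryValue
  exact ⟨G, hG, fun G' hG' => IsBoundaryValue.unique hF hG' hG⟩
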